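/- Let $M$ be a smooth manifold of dimension $n$, let $p\in M$, let $k\ge 0$, and let $\chi_k$ be the bundle over $M$ whose sections are the scalar linear differential operators of order $\le k$ with real coefficients. Fix local coordinates $(x_1,\dots,x_n)$ near $p$. Writing operators as $A=\sum_{|\alpha|\le k}a^\alpha(x)\,\partial^{|\alpha|}/\partial x^\alpha$, we obtain coordinates $u^\alpha_\sigma$ ($|\alpha|\le k$, $|\sigma|\le l$) on the fibre $J^l_p(\chi_k)$ of $l$-jets of operators at $p$, where $u^\alpha_\sigma([A]^l_p)=\partial^{|\sigma|}a^\alpha/\partial x^\sigma(p)$. The group of jets at $p$ of local diffeomorphisms $\phi$ of $M$ with $\phi(p)=p$ acts linearly on these fibres by $[A]^l_p\mapsto[\phi_*\circ A\circ\phi_*^{-1}]^l_p$, where $\phi_*f=f\circ\phi^{-1}$. A natural rational invariant (of order $\le l$) is a rational function on $J^l_p(\chi_k)$ that is invariant under this action. The natural rational invariants of all orders $l$ form a subfield of the field $\mathcal R$ of rational functions over $\mathbb R$ in the variables $u^\alpha_\sigma$ ($|\alpha|\le k$, $\sigma\in\mathbb N^n$). Let $\frac{d}{dx_i}$ be the total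 derivative, i.e. the derivation of $\mathcal R$ over $\mathbb R$ with $u^\alpha_\sigma\mapsto u^\alpha_{\sigma+1_i}$; let $\widehat d F=\sum_i\frac{dF}{dx_i}\,dx_i$ be the total differential, and let $\square=\sum_{|\alpha|\le k}u^\alpha_0\,\frac{d^{|\alpha|}}{dx^\alpha}$ be the universal total differential operator. Theorem (principle of $n$ invariants). Let $J_1,\dots,J_n$ be natural rational invariants (of any orders) in general position, that is, $\widehat dJ_1\wedge\cdots\wedge\widehat dJ_n\ne0$. For $F\in\mathcal R$ let the Tresse derivatives $\frac{dF}{dJ_i}\in\mathcal R$ be the unique elements with $\widehat dF=\sum_i\frac{dF}{dJ_i}\,\widehat dJ_i$. Then the field of all natural rational invariants coincides with the subfield of $\mathcal R$ generated over $\mathbb R$ by $J_1,\dots,J_n$ together with all the iterated Tresse derivatives $$\frac{d^{|\beta|}J_\alpha}{dJ^\beta},\qquad \beta\in\mathbb N^n,\quad 0\le|\alpha|\le k,$$ of $J_\alpha=\square\left(J_1^{\alpha_1}\cdots J_n^{\alpha_n}\right)$. -/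

import Mathlib

open scoped Manifold ContDiff Topology

noncomputable section

namespace ScalarDiffOp

/-- The composite `D₀^σ₀ ∘ D₁^σ₁ ∘ ⋯` of the iterates of the maps `D i : X → X`. -/
def multiIter {X : Type*} {n : ℕ} (D : Fin n → X → X) (σ : Fin n → ℕ) : X → X :=
  (List.ofFn fun i => (D i)^[σ i]).foldr (fun f g => f ∘ g) id

/-- Multi-indices `α = (α₁, …, αₙ)` of length `|α| ≤ k`. -/
abbrev Idx (n k : ℕ) : Type :=
  {α : Fin n → Fin (k + 1) // ∑ i, (α i : ℕ) ≤ k}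

/-- The natural-number entries of a multi-index of length at most `k`. -/
def Idx.entries {n k : ℕ} (α : Idx n k) : Fin n → ℕ := fun i => (α.1 i : ℕ)

/-! ### Operators, their jets, and the action of local diffeomorphisms -/

/-- The partial derivative `∂f/∂xᵢ` of a function on `ℝⁿ`. -/
def partialD {n : ℕ} (i : Fin n) (f : EuclideanSpace ℝ (Fin n) → ℝ) :
    EuclideanSpace ℝ (Fin n) → ℝ :=
  fun y => fderiv ℝ f y (EuclideanSpace.single i 1)

/-- The coefficients `a^α(x)`, `|α| ≤ k`, of a scalar operator `∑ a^α ∂^α` of order at most `k`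
in a chart. Only their values near the point under consideration matter. -/
abbrev Coeffs (n k : ℕ) : Type := Idx n k → EuclideanSpace ℝ (Fin n) → ℝ

/-- The coefficients are smooth near the point `y`. -/
def Coeffs.SmoothNear {n k : ℕ} (a : Coeffs n k) (y : EuclideanSpace ℝ (Fin n)) : Prop :=
  ∀ α, ∀ᶠ z in 𝓝 y, ContDiffAt ℝ ∞ (a α) z

/-- The operator `A = ∑_{|α| ≤ k} a^α(x) ∂^{|α|}/∂x^α`, written in the chart `e` of `M`,
applied to a function `f` on `M` (meaningful at points of `e.source` near which `f` is smooth). -/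
def diffOp {M : Type*} [TopologicalSpace M] {n k : ℕ}
    (e : OpenPartialHomeomorph M (EuclideanSpace ℝ (Fin n))) (a : Coeffs n k)
    (f : M → ℝ) : M → ℝ :=
  fun x => ∑ α, a α (e x) * multiIter partialD α.entries (f ∘ e.symm) (e x)

/-- The canonical coordinates `u^α_σ`, `|α| ≤ k`, `σ ∈ ℕⁿ`, on the fibre over a point of the space
of infinite jets of operators of order at most `k`. -/
abbrev JetVar (n k : ℕ) : Type := Idx n k × (Fin n → ℕ)

/-- The jet at `y`: the value of the coordinate `u^α_σ` is `∂^σ a^α (y)`. -/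
def jet {n k : ℕ} (a : Coeffs n k) (y : EuclideanSpace ℝ (Fin n)) : JetVar n k → ℝ :=
  fun v => multiIter partialD v.2 (a v.1) y

/-- `B = φ_* A = φ_* ∘ A ∘ φ_*⁻¹` as germs at `p = φ p`, that is `B(f) ∘ φ = A(f ∘ φ)` for all
functions `f` that are smooth near `p`. Here `a` and `b` are the coefficients of `A` and `B` in the
chart `e`. -/
def IsPushforward {M : Type*} [TopologicalSpace M] {n k : ℕ}
    [ChartedSpace (EuclideanSpace ℝ (Fin n)) M]
    (e : OpenPartialHomeomorph M (EuclideanSpace ℝ (Fin n))) (p : M)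
    (φ : M → M) (a b : Coeffs n k) : Prop :=
  ∀ f : M → ℝ, (∀ᶠ x in 𝓝 p, ContMDiffAt (𝓡 n) 𝓘(ℝ, ℝ) ∞ f x) →
    ∀ᶠ x in 𝓝 p, diffOp e b f (φ x) = diffOp e a (f ∘ φ) x

/-! ### Natural rational invariants -/

/-- Rational functions of the jet coordinates. Each depends on finitely many
coordinates, hence is a rational function on the fibre of `l`-jets for some `l`. -/
abbrev RatFun (n k : ℕ) : Type := FractionRing (MvPolynomial (JetVar n k) ℝ)

/-- The rational function `F` on jets at `p` is invariant under the action of the jets at `p` of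
all local diffeomorphisms `φ` of `M` with `φ p = p` (the differential group). For `F = P / Q` and
the induced linear map `g` of the jet space, `F ∘ g = F` means `P · (Q ∘ g) = (P ∘ g) · Q`. -/
def IsNatural {M : Type*} [TopologicalSpace M] {n k : ℕ}
    [ChartedSpace (EuclideanSpace ℝ (Fin n)) M]
    (e : OpenPartialHomeomorph M (EuclideanSpace ℝ (Fin n))) (p : M) (F : RatFun n k) : Prop :=
  ∃ P Q : MvPolynomial (JetVar n k) ℝ, Q ≠ 0 ∧
    F = algebraMap _ (RatFun n k) P / algebraMap _ (RatFun n k) Q ∧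
    ∀ (φ : PartialDiffeomorph (𝓡 n) (𝓡 n) M M ∞) (a b : Coeffs n k),
      p ∈ φ.source → φ p = p → a.SmoothNear (e p) → b.SmoothNear (e p) →
      IsPushforward e p φ a b →
      P.eval (jet a (e p)) * Q.eval (jet b (e p)) = P.eval (jet b (e p)) * Q.eval (jet a (e p))

/-- The field of all natural rational invariants (of arbitrary order) of scalar operators of
order at most `k`. -/
def naturalField {M : Type*} [TopologicalSpace M] {n : ℕ} (k : ℕ)
    [ChartedSpace (EuclideanSpace ℝ (Fin n)) M]
    (e : OpenPartialHomeomorph M (EuclideanSpace ℝ (Fin n))) (p : M) :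
    IntermediateField ℝ (RatFun n k) where
  carrier := {F | IsNatural e p F}
  mul_mem' := by
    rintro _ _ ⟨P, Q, hQ, rfl, h⟩ ⟨R, S, hS, rfl, h'⟩
    refine ⟨P * R, Q * S, mul_ne_zero hQ hS, by simp [div_mul_div_comm], ?_⟩
    intro φ a b h1 h2 h3 h4 h5
    have e1 := h φ a b h1 h2 h3 h4 h5
    have e2 := h' φ a b h1 h2 h3 h4 h5
    simp only [map_mul]
    linear_combination (R.eval (jet a (e p)) * S.eval (jet b (e p))) * e1 +
      (P.eval (jet b (e p)) * Q.eval (jet a (e p))) * e2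
  add_mem' := by
    rintro _ _ ⟨P, Q, hQ, rfl, h⟩ ⟨R, S, hS, rfl, h'⟩
    refine ⟨P * S + Q * R, Q * S, mul_ne_zero hQ hS, ?_, ?_⟩
    · have hQ' : algebraMap _ (RatFun n k) Q ≠ 0 := by simpa using hQ
      have hS' : algebraMap _ (RatFun n k) S ≠ 0 := by simpa using hS
      rw [div_add_div _ _ hQ' hS']
      simp
    intro φ a b h1 h2 h3 h4 h5
    have e1 := h φ a b h1 h2 h3 h4 h5
    have e2 := h' φ a b h1 h2 h3 h4 h5
    simp only [map_mul, map_add]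
    linear_combination (S.eval (jet a (e p)) * S.eval (jet b (e p))) * e1 +
      (Q.eval (jet a (e p)) * Q.eval (jet b (e p))) * e2
  algebraMap_mem' := by
    intro r
    refine ⟨MvPolynomial.C r, 1, one_ne_zero, ?_, ?_⟩
    · rw [map_one, div_one]
      exact IsScalarTower.algebraMap_apply ℝ (MvPolynomial (JetVar n k) ℝ) (RatFun n k) r
    · intro φ a b _ _ _ _ _
      simp
  inv_mem' := by
    rintro _ ⟨P, Q, hQ, rfl, h⟩
    by_cases hP : P = 0
    · subst hP
      refine ⟨0, 1, one_ne_zero, by simp, ?_⟩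
      intro φ a b _ _ _ _ _
      simp
    · refine ⟨Q, P, hP, by simp, ?_⟩
      intro φ a b h1 h2 h3 h4 h5
      have e1 := h φ a b h1 h2 h3 h4 h5
      linear_combination -e1

/-! ### Total derivatives, the universal operator and Tresse derivatives -/

section FractionDerivation

variable {R A K : Type*} [CommRing R] [CommRing A] [IsDomain A] [Algebra R A] [Field K]
  [Algebra A K] [IsFractionRing A K]

/-- The quotient rule applied to a representation of `F` as a fraction. -/
def fracDerivFun (d : Derivation R A A) (F : K) : K :=
  (algebraMap A K (d (IsLocalization.sec (nonZeroDivisors A) F).1) *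
      algebraMap A K (IsLocalization.sec (nonZeroDivisors A) F).2 -
    algebraMap A K (IsLocalization.sec (nonZeroDivisors A) F).1 *
      algebraMap A K (d (IsLocalization.sec (nonZeroDivisors A) F).2)) /
    algebraMap A K (IsLocalization.sec (nonZeroDivisors A) F).2 ^ 2

theorem fracDerivFun_div (d : Derivation R A A) (P Q : A) (hQ : Q ≠ 0) :
    fracDerivFun d (algebraMap A K P / algebraMap A K Q) =
      (algebraMap A K (d P) * algebraMap A K Q - algebraMap A K P * algebraMap A K (d Q)) /
        algebraMap A K Q ^ 2 := by
  unfold fracDerivFun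
  set F := algebraMap A K P / algebraMap A K Q with hF
  have hsec := IsLocalization.sec_spec (nonZeroDivisors A) F
  have hS := nonZeroDivisors.ne_zero (IsLocalization.sec (nonZeroDivisors A) F).2.2
  generalize (IsLocalization.sec (nonZeroDivisors A) F).1 = T at *
  generalize ((IsLocalization.sec (nonZeroDivisors A) F).2 : A) = S at *
  have hQ' : algebraMap A K Q ≠ 0 := by simpa using hQ
  have hS' : algebraMap A K S ≠ 0 := by simpa using hS
  have key : T * Q = P * S := by
    rw [hF, div_mul_eq_mul_div, div_eq_iff hQ', ← map_mul, ← map_mul] at hsec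
    exact (IsFractionRing.injective A K hsec).symm
  have dkey := congrArg d key
  simp only [Derivation.leibniz, smul_eq_mul] at dkey
  rw [div_eq_div_iff (pow_ne_zero 2 hS') (pow_ne_zero 2 hQ')]
  simp only [← map_mul, ← map_sub, ← map_pow]
  congr 1
  linear_combination (Q * S) * dkey - (S * d Q + Q * d S) * key

theorem fracDerivFun_add (d : Derivation R A A) (x y : K) :
    fracDerivFun d (x + y) = fracDerivFun d x + fracDerivFun d y := by
  obtain ⟨P, Q, hQ, rfl⟩ := IsFractionRing.div_surjective (A := A) x
  obtain ⟨T, S, hS, rfl⟩ := IsFractionRing.div_surjective (A := A) y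
  have hQ0 := nonZeroDivisors.ne_zero hQ
  have hS0 := nonZeroDivisors.ne_zero hS
  have hQ' : algebraMap A K Q ≠ 0 := by simpa using hQ0
  have hS' : algebraMap A K S ≠ 0 := by simpa using hS0
  rw [div_add_div _ _ hQ' hS', ← map_mul, ← map_mul, ← map_mul, ← map_add,
    fracDerivFun_div d _ _ (mul_ne_zero hQ0 hS0), fracDerivFun_div d _ _ hQ0,
    fracDerivFun_div d _ _ hS0]
  simp only [map_add, map_mul, Derivation.leibniz, smul_eq_mul]
  field_simp
  ring

theorem fracDerivFun_mul (d : Derivation R A A) (x y : K) :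
    fracDerivFun d (x * y) = x * fracDerivFun d y + y * fracDerivFun d x := by
  obtain ⟨P, Q, hQ, rfl⟩ := IsFractionRing.div_surjective (A := A) x
  obtain ⟨T, S, hS, rfl⟩ := IsFractionRing.div_surjective (A := A) y
  have hQ0 := nonZeroDivisors.ne_zero hQ
  have hS0 := nonZeroDivisors.ne_zero hS
  have hQ' : algebraMap A K Q ≠ 0 := by simpa using hQ0
  have hS' : algebraMap A K S ≠ 0 := by simpa using hS0
  rw [div_mul_div_comm, ← map_mul, ← map_mul,
    fracDerivFun_div d _ _ (mul_ne_zero hQ0 hS0), fracDerivFun_div d _ _ hQ0,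
    fracDerivFun_div d _ _ hS0]
  simp only [map_add, map_mul, Derivation.leibniz, smul_eq_mul]
  field_simp
  ring

theorem fracDerivFun_algebraMap (d : Derivation R A A) (P : A) :
    fracDerivFun d (algebraMap A K P) = algebraMap A K (d P) := by
  have h := fracDerivFun_div (K := K) d P 1 one_ne_zero
  simpa using h

variable [Algebra R K] [IsScalarTower R A K]

/-- The extension of a derivation of a domain to its fraction field. -/
def fracDeriv (d : Derivation R A A) : Derivation R K K :=
  Derivation.mk'
    { toFun := fracDerivFun d
      map_add' := fracDerivFun_add d
      map_smul' := by
        intro r x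
        rw [RingHom.id_apply, Algebra.smul_def, IsScalarTower.algebraMap_apply R A K,
          fracDerivFun_mul, fracDerivFun_algebraMap, Derivation.map_algebraMap, map_zero,
          mul_zero, add_zero, Algebra.smul_def, IsScalarTower.algebraMap_apply R A K] }
    (fracDerivFun_mul d)

theorem fracDeriv_algebraMap (d : Derivation R A A) (P : A) :
    fracDeriv d (algebraMap A K P) = algebraMap A K (d P) :=
  fracDerivFun_algebraMap d P

end FractionDerivation

/-- The total derivative `d/dxᵢ` on polynomials in the jet coordinates, `u^α_σ ↦ u^α_{σ+1ᵢ}`. -/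
def polyTotalD {n k : ℕ} (i : Fin n) :
    Derivation ℝ (MvPolynomial (JetVar n k) ℝ) (MvPolynomial (JetVar n k) ℝ) :=
  MvPolynomial.mkDerivation ℝ fun v => MvPolynomial.X (v.1, v.2 + Pi.single i 1)

/-- The total derivative `d/dxᵢ` on rational functions of the jet coordinates. -/
def totalD {n k : ℕ} (i : Fin n) : Derivation ℝ (RatFun n k) (RatFun n k) :=
  fracDeriv (polyTotalD (k := k) i)

/-- The total differential `d̂F = ∑ᵢ (dF/dxᵢ) dxᵢ`, a horizontal form given by its components in
the basis `dx₁, …, dxₙ`. -/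
def totalDifferential {n k : ℕ} (F : RatFun n k) : Fin n → RatFun n k := fun i => totalD i F

/-- General position: `d̂J₁ ∧ ⋯ ∧ d̂Jₙ ≠ 0`. -/
def GeneralPosition {n k : ℕ} (J : Fin n → RatFun n k) : Prop :=
  ExteriorAlgebra.ιMulti (RatFun n k) n (fun i => totalDifferential (J i)) ≠ 0

/-- The universal total operator `□ = ∑_{|α| ≤ k} u^α d^{|α|}/dx^α`. -/
def box {n k : ℕ} (F : RatFun n k) : RatFun n k :=
  ∑ α : Idx n k, algebraMap (MvPolynomial (JetVar n k) ℝ) _ (MvPolynomial.X (α, 0)) *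
    multiIter (fun i => (totalD i : RatFun n k → RatFun n k)) α.entries F

/-- The Tresse derivative `dF/dJᵢ`: the `i`-th coefficient in `d̂F = ∑ᵢ (dF/dJᵢ) d̂Jᵢ`
(for `J` in general position). -/
def tresse {n k : ℕ} (J : Fin n → RatFun n k) (i : Fin n) (F : RatFun n k) : RatFun n k :=
  ((Matrix.of fun j i => totalDifferential (J i) j)⁻¹.mulVec (totalDifferential F)) i

theorem GeneralPosition.linearIndependent {n k : ℕ} {J : Fin n → RatFun n k}
    (hJ : GeneralPosition J) :
    LinearIndependent (RatFun n k) fun i => totalDifferential (J i) := by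
  by_contra h
  exact hJ (AlternatingMap.map_linearDependent _ _ h)

theorem GeneralPosition.isUnit {n k : ℕ} {J : Fin n → RatFun n k} (hJ : GeneralPosition J) :
    IsUnit (Matrix.of fun j i => totalDifferential (J i) j) :=
  Matrix.linearIndependent_cols_iff_isUnit.mp hJ.linearIndependent

/-- The defining property of the Tresse derivatives. -/
theorem totalDifferential_eq_sum_tresse {n k : ℕ} {J : Fin n → RatFun n k}
    (hJ : GeneralPosition J) (F : RatFun n k) :
    totalDifferential F = ∑ i, tresse J i F • totalDifferential (J i) := by
  have hdet := (Matrix.isUnit_iff_isUnit_det _).mp hJ.isUnit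
  have h : (Matrix.of fun j i => totalDifferential (J i) j).mulVec
      (fun i => tresse J i F) = totalDifferential F := by
    change Matrix.mulVec _ (Matrix.mulVec _ _) = _
    rw [Matrix.mulVec_mulVec, Matrix.mul_nonsing_inv _ hdet, Matrix.one_mulVec]
  rw [← h]
  ext j
  simp [Matrix.mulVec, dotProduct, mul_comm]

/-- They are the only coefficients with this property. -/
theorem tresse_unique {n k : ℕ} {J : Fin n → RatFun n k} (hJ : GeneralPosition J)
    (F : RatFun n k) (c : Fin n → RatFun n k)
    (hc : totalDifferential F = ∑ i, c i • totalDifferential (J i)) (i : Fin n) :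
    c i = tresse J i F :=
  congrFun (hJ.linearIndependent.fintypeLinearCombination_injective
    (hc.symm.trans (totalDifferential_eq_sum_tresse hJ F))) i

/-- The invariant `J_α = □(J₁^α₁ ⋯ Jₙ^αₙ)`. -/
def boxMonomial {n k : ℕ} (J : Fin n → RatFun n k) (α : Idx n k) : RatFun n k :=
  box (∏ i, J i ^ α.entries i)

end ScalarDiffOp

end

/-! Invariance under all local diffeomorphisms amounts to a single algebraic identity. Adjoin to the
operator coefficients `n` further unknowns, the components of a generic map `φ`, and work in the
field `DField n (GVar n k)` of differential rational functions of all of them. There the derivations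
`∂/∂φ_j` (`nab`) exist and commute. Rewriting `∑ u^α d^α` through them gives coefficients
`frameCoeff`, whose iterated derivatives `frameJet` are the jet of `φ_* A`. So `F ↦ F(jet of φ_* A)`
(`pushHom`) and `F ↦ F(jet of A)` (`inclHom`) are two embeddings of `RatFun n k`, and `F` is natural
exactly when they agree on it (`isNatural_iff`).

The generated field consists of invariants because `□` and the Tresse derivatives are coordinate
free (`pushHom_box`, `pushHom_tresse`).

Conversely, specialize the identity to a frame made of invariants. In the frame `J` the jet of the
operator consists of Tresse derivatives of its coefficients, and these coefficients solve a
triangular linear system with right-hand sides `J_α` (`coeff_mem`). This would express `F` through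
the generators, except that the operator written in the coordinates `J` is not generic, so a given
denominator of `F` may vanish there. The remedy is a frame `h(J)` with polynomials `h`. Such maps
have arbitrary finite jets, hence some `h` avoids the zeros of any given nonzero differential
polynomial (`exists_polynomial_frame`), and the chain rule keeps all quantities inside the generated
field (`mem_of_invariant`).

Algebra and analysis are linked by specialization (`specGraph`): differential rational functions
take values in the ring of smooth functions on an open set, where frames are actual local
coordinates, and polynomial functions realize all finite jets. -/

noncomputable section

namespace ScalarDiffOp

/-! ### Iterates of families of maps -/

section MultiIter

variable {X Y : Type*} {n : ℕ}

theorem multiIter_eq (D : Fin n → X → X) (σ : Fin n → ℕ) :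
    multiIter D σ = ((List.finRange n).map fun i => (D i)^[σ i]).foldr (fun f g => f ∘ g) id := by
  rw [multiIter, List.ofFn_eq_map]

/-- A relation preserved by each pair `D i`, `E i` is preserved by their iterates. -/
theorem multiIter_rel {D : Fin n → X → X} {E : Fin n → Y → Y} {r : X → Y → Prop}
    (h : ∀ i x y, r x y → r (D i x) (E i y)) (σ : Fin n → ℕ) {x : X} {y : Y} (hxy : r x y) :
    r (multiIter D σ x) (multiIter E σ y) := by
  rw [multiIter_eq, multiIter_eq]
  have iter : ∀ (i : Fin n) (m : ℕ) (x : X) (y : Y), r x y → r ((D i)^[m] x) ((E i)^[m] y) := by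
    intro i m
    induction m with
    | zero => exact fun _ _ h => h
    | succ m ih => exact fun x y hxy => ih _ _ (h i x y hxy)
  induction List.finRange n with
  | nil => exact hxy
  | cons i l ih => exact iter i _ _ _ ih

theorem multiIter_mem {D : Fin n → X → X} {s : Set X} (h : ∀ i, ∀ x ∈ s, D i x ∈ s)
    (σ : Fin n → ℕ) {x : X} (hx : x ∈ s) : multiIter D σ x ∈ s :=
  multiIter_rel (D := D) (E := D) (r := fun x _ => x ∈ s) (fun i x _ hx => h i x hx) σ (y := x) hx

theorem multiIter_semiconj {D : Fin n → X → X} {E : Fin n → Y → Y} {f : X → Y}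
    (h : ∀ i x, f (D i x) = E i (f x)) (σ : Fin n → ℕ) (x : X) :
    f (multiIter D σ x) = multiIter E σ (f x) :=
  multiIter_rel (D := D) (E := E) (r := fun x y => f x = y)
    (fun i x y hxy => by rw [h, hxy]) σ rfl

@[simp]
theorem multiIter_zero (D : Fin n → X → X) (x : X) : multiIter D 0 x = x := by
  rw [multiIter_eq]
  induction List.finRange n with
  | nil => rfl
  | cons i l ih => simpa using ih

/-- `multiIter` composes in a fixed order; commutation lets the additional `D i` be pulled out to
the left. -/
theorem multiIter_add_single {D : Fin n → X → X} (hD : ∀ i j x, D i (D j x) = D j (D i x))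
    (σ : Fin n → ℕ) (i : Fin n) (x : X) :
    multiIter D (σ + Pi.single i 1) x = D i (multiIter D σ x) := by
  rw [multiIter_eq, multiIter_eq]
  have key : ∀ l : List (Fin n), l.Nodup →
      (l.map fun j => (D j)^[(σ + Pi.single i 1 : Fin n → ℕ) j]).foldr (fun f g => f ∘ g) id x =
        if i ∈ l then D i ((l.map fun j => (D j)^[σ j]).foldr (fun f g => f ∘ g) id x)
        else (l.map fun j => (D j)^[σ j]).foldr (fun f g => f ∘ g) id x := by
    intro l
    induction l with
    | nil => simp
    | cons j l ih =>
      intro hl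
      rw [List.nodup_cons] at hl
      have ih := ih hl.2
      simp only [List.map_cons, List.foldr_cons, Function.comp_apply, ih]
      by_cases hij : j = i
      · subst hij
        simp [hl.1, Function.iterate_succ_apply']
      · have hc : ∀ y, (D j)^[σ j] (D i y) = D i ((D j)^[σ j] y) := fun y =>
          (Function.Commute.iterate_left (fun y => hD j i y : Function.Commute (D j) (D i)) _ y)
        have hij' : i ≠ j := fun h => hij h.symm
        by_cases hi : i ∈ l <;> simp [hi, hij', hc]
  simpa using key _ (List.nodup_finRange n)

theorem multiIter_single (D : Fin n → X → X) (i : Fin n) (x : X) :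
    multiIter D (Pi.single i 1) x = D i x := by
  rw [multiIter_eq]
  have key : ∀ l : List (Fin n), l.Nodup →
      (l.map fun j => (D j)^[(Pi.single i 1 : Fin n → ℕ) j]).foldr (fun f g => f ∘ g) id x =
        if i ∈ l then D i x else x := by
    intro l
    induction l with
    | nil => simp
    | cons j l ih =>
      intro hl
      rw [List.nodup_cons] at hl
      have ih := ih hl.2
      simp only [List.map_cons, List.foldr_cons, Function.comp_apply, ih]
      by_cases hij : j = i
      · subst hij
        simp [hl.1]
      · have hij' : i ≠ j := fun h => hij h.symm
        simp [hij']
  simpa using key _ (List.nodup_finRange n)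

/-- Induction on multi-indices. -/
theorem multiIndex_induction {P : (Fin n → ℕ) → Prop} (zero : P 0)
    (add : ∀ σ i, P σ → P (σ + Pi.single i 1)) (σ : Fin n → ℕ) : P σ := by
  suffices h : ∀ (m : ℕ) (σ : Fin n → ℕ), ∑ i, σ i = m → P σ from h _ σ rfl
  intro m
  induction m with
  | zero =>
    intro σ hσ
    have : σ = 0 := funext fun i => (Finset.sum_eq_zero_iff.mp hσ) i (Finset.mem_univ i)
    exact this ▸ zero
  | succ m ih =>
    intro σ hσ
    obtain ⟨i, -, hi⟩ : ∃ i ∈ Finset.univ, σ i ≠ 0 := by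
      apply Finset.exists_ne_zero_of_sum_ne_zero
      omega
    have hσ' : σ = (σ - Pi.single i 1) + Pi.single i 1 := by
      funext j
      by_cases hj : j = i
      · subst hj
        simp
        omega
      · simp [Pi.single_eq_of_ne hj]
    rw [hσ']
    apply add
    apply ih
    rw [hσ'] at hσ
    simp only [Pi.add_apply, Finset.sum_add_distrib, Finset.sum_pi_single', Finset.mem_univ,
      if_true] at hσ
    omega

end MultiIter

/-! ### Differential polynomials and differential rational functions -/

section DiffPoly

variable {n : ℕ} {I : Type}

/-- Differential polynomials in the unknowns `I` and `n` commuting derivations. -/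
abbrev DPoly (n : ℕ) (I : Type) : Type := MvPolynomial (I × (Fin n → ℕ)) ℝ

/-- Differential rational functions. -/
abbrev DField (n : ℕ) (I : Type) : Type := FractionRing (DPoly n I)

/-- The derivations of the ring of differential polynomials. -/
def polyD (i : Fin n) : Derivation ℝ (DPoly n I) (DPoly n I) :=
  MvPolynomial.mkDerivation ℝ fun v => MvPolynomial.X (v.1, v.2 + Pi.single i 1)

/-- The derivations of the field of differential rational functions. -/
def fieldD (i : Fin n) : Derivation ℝ (DField n I) (DField n I) :=
  fracDeriv (polyD (I := I) i)

@[simp]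
theorem polyD_X (i : Fin n) (v : I × (Fin n → ℕ)) :
    polyD i (MvPolynomial.X v : DPoly n I) = MvPolynomial.X (v.1, v.2 + Pi.single i 1) :=
  MvPolynomial.mkDerivation_X _ _ _

/-- The commutator of two derivations is a derivation, so it suffices to look at the variables. -/
theorem polyD_comm (i j : Fin n) (P : DPoly n I) : polyD i (polyD j P) = polyD j (polyD i P) := by
  have h : ⁅polyD (I := I) i, polyD (I := I) j⁆ = (0 : Derivation ℝ (DPoly n I) (DPoly n I)) := by
    apply MvPolynomial.derivation_ext
    intro v
    simp [Derivation.commutator_apply, add_right_comm]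
  have := congrArg (fun d : Derivation ℝ (DPoly n I) (DPoly n I) => d P) h
  simpa [Derivation.commutator_apply, sub_eq_zero] using this

theorem fieldD_algebraMap (i : Fin n) (P : DPoly n I) :
    fieldD i (algebraMap (DPoly n I) (DField n I) P) = algebraMap _ _ (polyD i P) :=
  fracDeriv_algebraMap _ _

/-- Two derivations of a fraction field which agree on the ring are equal. -/
theorem derivation_ext_frac {A K : Type*} [CommRing A] [IsDomain A] [Algebra ℝ A] [Field K]
    [Algebra A K] [IsFractionRing A K] [Algebra ℝ K] {M : Type*} [AddCommGroup M] [Module K M]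
    [Module ℝ M] {d d' : Derivation ℝ K M}
    (h : ∀ P : A, d (algebraMap A K P) = d' (algebraMap A K P)) : d = d' := by
  ext F
  obtain ⟨P, Q, hQ, rfl⟩ := IsFractionRing.div_surjective (A := A) F
  have hQ' : algebraMap A K Q ≠ 0 := by simpa using nonZeroDivisors.ne_zero hQ
  have e : ∀ d : Derivation ℝ K M, algebraMap A K Q • d (algebraMap A K P / algebraMap A K Q) =
      d (algebraMap A K P) -
        (algebraMap A K P / algebraMap A K Q) • d (algebraMap A K Q) := by
    intro d
    have h1 : d (algebraMap A K P) =
        d ((algebraMap A K P / algebraMap A K Q) * algebraMap A K Q) := by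
      rw [div_mul_cancel₀ _ hQ']
    rw [h1, Derivation.leibniz, add_sub_cancel_left]
  refine smul_right_injective M hQ' (?_ : _ • _ = _ • _)
  rw [e, e, h, h]

theorem fieldD_comm (i j : Fin n) (F : DField n I) :
    fieldD i (fieldD j F) = fieldD j (fieldD i F) := by
  have h : ⁅fieldD (I := I) i, fieldD (I := I) j⁆ =
      (0 : Derivation ℝ (DField n I) (DField n I)) := by
    apply derivation_ext_frac (A := DPoly n I)
    intro P
    simp [Derivation.commutator_apply, fieldD_algebraMap, polyD_comm i j]
  have := congrArg (fun d : Derivation ℝ (DField n I) (DField n I) => d F) h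
  simpa [Derivation.commutator_apply, sub_eq_zero] using this

variable {L : Type} [CommRing L] [Algebra ℝ L] (d : Fin n → Derivation ℝ L L)

/-- The substitution of `w i` and its derivatives for the unknown `i`. -/
def diffHom (w : I → L) : DPoly n I →ₐ[ℝ] L :=
  MvPolynomial.aeval fun v => multiIter (fun i => d i) v.2 (w v.1)

@[simp]
theorem diffHom_X (w : I → L) (v : I × (Fin n → ℕ)) :
    diffHom d w (MvPolynomial.X v) = multiIter (fun i => d i) v.2 (w v.1) :=
  MvPolynomial.aeval_X _ _

variable {d}

/-- On a variable, shifting the multi-index means one more derivation, because the `d i` commute.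
This makes `diffHom` a morphism of differential rings. -/
theorem diffHom_polyD (hd : ∀ i j x, d i (d j x) = d j (d i x)) (w : I → L) (i : Fin n)
    (P : DPoly n I) : diffHom d w (polyD i P) = d i (diffHom d w P) := by
  induction P using MvPolynomial.induction_on with
  | C r =>
    rw [← MvPolynomial.algebraMap_eq, Derivation.map_algebraMap, AlgHom.commutes,
      Derivation.map_algebraMap, map_zero]
  | add P Q hP hQ => simp only [map_add, hP, hQ]
  | mul_X P v hP =>
    simp only [Derivation.leibniz, map_add, smul_eq_mul, map_mul, hP, polyD_X, diffHom_X]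
    rw [multiIter_add_single (D := fun i => d i) hd]

end DiffPoly


/-! ### Frames: coordinates in a ring with commuting derivations -/

section Frame

variable {n : ℕ} {L : Type} [CommRing L] [Algebra ℝ L]

/-- The derivations commute pairwise. -/
def CommDer (d : Fin n → Derivation ℝ L L) : Prop := ∀ i j x, d i (d j x) = d j (d i x)

theorem commDer_fieldD {I : Type} : CommDer (fieldD : Fin n → Derivation ℝ (DField n I) _) :=
  fieldD_comm

/-- The Jacobian matrix of `g`. -/
def jac (d : Fin n → Derivation ℝ L L) (g : Fin n → L) : Matrix (Fin n) (Fin n) L :=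
  Matrix.of fun l i => d i (g l)

/-- The partial derivatives with respect to the coordinates `g`. -/
def nab (d : Fin n → Derivation ℝ L L) (g : Fin n → L) (j : Fin n) : Derivation ℝ L L :=
  ∑ i, (jac d g)⁻¹ i j • d i

theorem nab_apply (d : Fin n → Derivation ℝ L L) (g : Fin n → L) (j : Fin n) (x : L) :
    nab d g j x = ∑ i, (jac d g)⁻¹ i j * d i x := by
  have := map_sum (Derivation.coeFnAddMonoidHom (R := ℝ) (A := L) (M := L))
    (fun i => (jac d g)⁻¹ i j • d i) Finset.univ
  exact (congrFun this x).trans (by simp)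

variable {d : Fin n → Derivation ℝ L L} {g : Fin n → L}

theorem nab_coord (hg : IsUnit (jac d g).det) (j l : Fin n) :
    nab d g j (g l) = if l = j then 1 else 0 := by
  have h := congrFun (congrFun (Matrix.mul_nonsing_inv _ hg) l) j
  rw [Matrix.mul_apply, Matrix.one_apply] at h
  rw [nab_apply, ← h]
  exact Finset.sum_congr rfl fun i _ => mul_comm _ _

/-- The chain rule: `nab` is defined by the inverse Jacobian, and multiplying by the Jacobian gives
the `d i` back. -/
theorem eq_sum_nab (hg : IsUnit (jac d g).det) (i : Fin n) (x : L) :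
    d i x = ∑ j, d i (g j) * nab d g j x := by
  simp only [nab_apply, Finset.mul_sum]
  rw [Finset.sum_comm]
  have h : ∀ m, ∑ j, d i (g j) * ((jac d g)⁻¹ m j * d m x) = if m = i then d m x else 0 := by
    intro m
    have h := congrFun (congrFun (Matrix.nonsing_inv_mul _ hg) m) i
    rw [Matrix.mul_apply, Matrix.one_apply] at h
    have h' : ∑ j, d i (g j) * ((jac d g)⁻¹ m j * d m x) =
        (∑ j, (jac d g)⁻¹ m j * jac d g j i) * d m x := by
      rw [Finset.sum_mul]
      refine Finset.sum_congr rfl fun j _ => ?_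
      simp only [jac, Matrix.of_apply]
      ring
    rw [h', h]
    split_ifs <;> simp
  simp [h]

/-- A combination of the `d i` which kills the coordinates vanishes. -/
theorem sum_smul_eq_zero (hg : IsUnit (jac d g).det) (c : Fin n → L)
    (h : ∀ l, ∑ i, c i * d i (g l) = 0) (x : L) : ∑ i, c i * d i x = 0 := by
  have : ∑ i, c i * d i x = ∑ j, (∑ i, c i * d i (g j)) * nab d g j x := by
    simp only [Finset.sum_mul]
    rw [Finset.sum_comm]
    refine Finset.sum_congr rfl fun i _ => ?_
    rw [eq_sum_nab hg i x, Finset.mul_sum]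
    exact Finset.sum_congr rfl fun j _ => by ring
  rw [this]
  simp [h]

/-- The second-order parts of the commutator cancel by symmetry, so it is a combination of the `d
m`. It kills the coordinates, whose `nab`-derivatives are constants, and therefore vanishes. -/
theorem nab_comm (hd : CommDer d) (hg : IsUnit (jac d g).det) : CommDer (nab d g) := by
  intro i j x
  have expand : ∀ i j x, nab d g i (nab d g j x) =
      ∑ m, nab d g i ((jac d g)⁻¹ m j) * d m x +
        ∑ m, ∑ l, (jac d g)⁻¹ m j * ((jac d g)⁻¹ l i * d l (d m x)) := by
    intro i j x
    rw [nab_apply d g j x]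
    simp only [map_sum, Derivation.leibniz, smul_eq_mul, Finset.sum_add_distrib]
    rw [add_comm]
    congr 1
    · exact Finset.sum_congr rfl fun m _ => mul_comm _ _
    · refine Finset.sum_congr rfl fun m _ => ?_
      rw [nab_apply, Finset.mul_sum]
  have diff : ∀ x, nab d g i (nab d g j x) - nab d g j (nab d g i x) =
      ∑ m, (nab d g i ((jac d g)⁻¹ m j) - nab d g j ((jac d g)⁻¹ m i)) * d m x := by
    intro x
    have sym : ∑ m, ∑ l, (jac d g)⁻¹ m j * ((jac d g)⁻¹ l i * d l (d m x)) =
        ∑ m, ∑ l, (jac d g)⁻¹ m i * ((jac d g)⁻¹ l j * d l (d m x)) := by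
      rw [Finset.sum_comm]
      refine Finset.sum_congr rfl fun m _ => Finset.sum_congr rfl fun l _ => ?_
      rw [hd m l x]
      ring
    rw [expand, expand, sym, add_sub_add_right_eq_sub, ← Finset.sum_sub_distrib]
    exact Finset.sum_congr rfl fun m _ => by ring
  rw [← sub_eq_zero, diff]
  apply sum_smul_eq_zero hg
  intro l
  rw [← diff, nab_coord hg, nab_coord hg]
  split_ifs <;> simp

/-! #### Monomials in the coordinates -/

/-- The falling factorial is zero as soon as `δ i > γ i` for some `i`. This makes the truncated
subtraction harmless and is the source of triangularity in `coeff_mem`. -/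
theorem multiIter_pderiv_monomial (γ δ : Fin n → ℕ) :
    multiIter (fun i => (MvPolynomial.pderiv (R := ℝ) i : MvPolynomial (Fin n) ℝ → _)) δ
        (MvPolynomial.monomial (Finsupp.equivFunOnFinite.symm γ) 1) =
      MvPolynomial.monomial (Finsupp.equivFunOnFinite.symm (γ - δ))
        (∏ i, ((γ i).descFactorial (δ i) : ℝ)) := by
  induction δ using multiIndex_induction with
  | zero => simp
  | add δ j ih =>
    rw [multiIter_add_single, ih, MvPolynomial.pderiv_monomial]
    · have he : Finsupp.equivFunOnFinite.symm (γ - δ) - Finsupp.single j 1 =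
          Finsupp.equivFunOnFinite.symm (γ - (δ + Pi.single j 1)) := by
        ext i
        by_cases hij : i = j
        · subst hij
          simp [Nat.sub_sub]
        · simp [hij]
      congr 1
      · rw [he]
      · rw [← Finset.mul_prod_erase _ _ (Finset.mem_univ j),
          ← Finset.mul_prod_erase _ (fun i => ((γ i).descFactorial _ : ℝ)) (Finset.mem_univ j)]
        have : ∀ i ∈ Finset.univ.erase j,
            ((γ i).descFactorial ((δ + Pi.single j 1 : Fin n → ℕ) i) : ℝ) =
              (γ i).descFactorial (δ i) := by
          intro i hi
          rw [Pi.add_apply, Pi.single_eq_of_ne (Finset.ne_of_mem_erase hi), add_zero]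
        rw [Finset.prod_congr rfl this]
        simp only [Pi.add_apply, Pi.single_eq_same, Nat.descFactorial_succ, Nat.cast_mul]
        simp
        ring
    · intro i j p
      have h : ⁅MvPolynomial.pderiv (R := ℝ) i, MvPolynomial.pderiv j⁆ =
          (0 : Derivation ℝ (MvPolynomial (Fin n) ℝ) (MvPolynomial (Fin n) ℝ)) := by
        apply MvPolynomial.derivation_ext
        intro v
        simp [Derivation.commutator_apply, MvPolynomial.pderiv_X, Pi.single_apply]
        split_ifs <;> simp
      have := congrArg (fun d : Derivation ℝ (MvPolynomial (Fin n) ℝ) _ => d p) h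
      simpa [Derivation.commutator_apply, sub_eq_zero] using this

theorem nab_aeval (hg : IsUnit (jac d g).det) (j : Fin n) (p : MvPolynomial (Fin n) ℝ) :
    MvPolynomial.aeval g (MvPolynomial.pderiv j p) = nab d g j (MvPolynomial.aeval g p) := by
  induction p using MvPolynomial.induction_on with
  | C r => simp
  | add p q hp hq => simp only [map_add, hp, hq]
  | mul_X p i hp =>
    simp only [Derivation.leibniz, map_add, smul_eq_mul, map_mul, hp, MvPolynomial.aeval_X,
      nab_coord hg, MvPolynomial.pderiv_X, Pi.single_apply]
    split_ifs <;> simp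

theorem prod_pow_eq_aeval (γ : Fin n → ℕ) :
    ∏ i, g i ^ γ i =
      MvPolynomial.aeval g (MvPolynomial.monomial (R := ℝ) (Finsupp.equivFunOnFinite.symm γ) 1) := by
  rw [MvPolynomial.aeval_monomial, map_one, one_mul, Finsupp.prod_fintype _ _ (by simp)]
  rfl

theorem multiIter_nab_aeval (hg : IsUnit (jac d g).det) (δ : Fin n → ℕ)
    (p : MvPolynomial (Fin n) ℝ) :
    multiIter (fun i => nab d g i) δ (MvPolynomial.aeval g p) =
      MvPolynomial.aeval g (multiIter (fun i => (MvPolynomial.pderiv (R := ℝ) i)) δ p) :=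
  (multiIter_semiconj (nab_aeval hg) δ p).symm

theorem Idx.entries_injective {k : ℕ} : Function.Injective (Idx.entries : Idx n k → _) := by
  intro α β h
  apply Subtype.ext
  funext i
  exact Fin.ext (congrFun h i)

theorem Idx.sum_entries_le {k : ℕ} (α : Idx n k) : ∑ i, α.entries i ≤ k := α.2

/-- The index with the given entries. -/
def Idx.mk' {k : ℕ} (γ : Fin n → ℕ) (h : ∑ i, γ i ≤ k) : Idx n k :=
  ⟨fun i => ⟨γ i, by
    have := Finset.single_le_sum (fun _ _ => Nat.zero_le _) (Finset.mem_univ i) (f := γ)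
    omega⟩, h⟩

/-- The coefficients of an operator belong to every module over the polynomials in the coordinates
which contains its values on the monomials. -/
theorem coeff_mem (hg : IsUnit (jac d g).det) {k : ℕ} (T : Submodule ℝ L)
    (hT : ∀ i, ∀ x ∈ T, x * g i ∈ T) (e : Idx n k → L)
    (h : ∀ γ : Idx n k, ∑ δ : Idx n k,
      e δ * multiIter (fun i => nab d g i) δ.entries (∏ i, g i ^ γ.entries i) ∈ T)
    (γ : Idx n k) : e γ ∈ T := by
  have hTp : ∀ x ∈ T, ∀ p : MvPolynomial (Fin n) ℝ, x * MvPolynomial.aeval g p ∈ T := by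
    intro x hx p
    induction p using MvPolynomial.induction_on with
    | C r =>
      rw [MvPolynomial.aeval_C, mul_comm, ← Algebra.smul_def]
      exact T.smul_mem _ hx
    | add p q hp hq =>
      rw [map_add, mul_add]
      exact T.add_mem hp hq
    | mul_X p i hp =>
      rw [map_mul, MvPolynomial.aeval_X, ← mul_assoc]
      exact hT _ _ hp
  induction hm : ∑ i, γ.entries i using Nat.strong_induction_on generalizing γ with
  | _ m ih =>
    have hγ := h γ
    rw [← Finset.add_sum_erase _ _ (Finset.mem_univ γ)] at hγ
    have hrest : ∑ δ ∈ Finset.univ.erase γ,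
        e δ * multiIter (fun i => nab d g i) δ.entries (∏ i, g i ^ γ.entries i) ∈ T := by
      refine T.sum_mem fun δ hδ => ?_
      -- For lower order, the induction hypothesis applies and the other factor is a polynomial in
      -- the coordinates.
      by_cases hlt : ∑ i, δ.entries i < m
      · rw [prod_pow_eq_aeval, multiIter_nab_aeval hg]
        exact hTp _ (ih _ hlt δ rfl) _
      -- An index `δ ≠ γ` with `|δ| ≥ |γ|` exceeds `γ` in some entry, so its derivative kills the
      -- monomial.
      · obtain ⟨i, hi⟩ : ∃ i, γ.entries i < δ.entries i := by
          by_contra! hle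
          apply Finset.ne_of_mem_erase hδ
          apply Idx.entries_injective
          funext i
          exact (Finset.sum_eq_sum_iff_of_le fun i _ => hle i).mp
            (le_antisymm (Finset.sum_le_sum fun i _ => hle i) (by omega)) i (Finset.mem_univ i)
        rw [prod_pow_eq_aeval, multiIter_nab_aeval hg, multiIter_pderiv_monomial,
          Finset.prod_eq_zero (Finset.mem_univ i)
            (by rw [Nat.descFactorial_of_lt hi, Nat.cast_zero])]
        simp
    -- Only the diagonal term remains, with the nonzero factor `γ!`.
    have hmain := (T.add_mem_iff_left hrest).mp hγ
    rw [prod_pow_eq_aeval, multiIter_nab_aeval hg, multiIter_pderiv_monomial, tsub_self,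
      MvPolynomial.aeval_monomial] at hmain
    have hz : (Finsupp.equivFunOnFinite.symm (0 : Fin n → ℕ)) = 0 := by ext; rfl
    rw [hz, Finsupp.prod_zero_index, mul_one, mul_comm, ← Algebra.smul_def] at hmain
    refine (T.smul_mem_iff ?_).mp hmain
    simp only [Nat.descFactorial_self]
    exact Finset.prod_ne_zero_iff.mpr fun i _ => Nat.cast_ne_zero.mpr (Nat.factorial_ne_zero _)

end Frame


/-! ### The universal chain rule -/

section ChainRule

variable {n : ℕ} {I : Type}

/-- The symbols `∑ m_γ ξ^γ` of operators in the frame of the unknowns `inr 1, …, inr n`. -/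
abbrev Symb (n : ℕ) (I : Type) : Type := (Fin n → ℕ) →₀ DPoly n (I ⊕ Fin n)

/-- The composition with the derivation `i`, on symbols. -/
def symbD (i : Fin n) : Symb n I →ₗ[ℝ] Symb n I :=
  Finsupp.lsum ℝ fun γ => (Finsupp.lsingle γ).comp (polyD i).toLinearMap +
    ∑ j : Fin n, (Finsupp.lsingle (γ + Pi.single j 1)).comp
      (LinearMap.mulRight ℝ (MvPolynomial.X (Sum.inr j, Pi.single i 1)))

/-- The symbol of the iterated derivation. -/
def chainSymb (α : Fin n → ℕ) : Symb n I :=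
  multiIter (fun i => symbD i) α (Finsupp.single 0 1)

theorem symbD_single (i : Fin n) (γ : Fin n → ℕ) (m : DPoly n (I ⊕ Fin n)) :
    symbD i (Finsupp.single γ m) = Finsupp.single γ (polyD i m) +
      ∑ j : Fin n, Finsupp.single (γ + Pi.single j 1)
        (m * MvPolynomial.X (Sum.inr j, Pi.single i 1)) := by
  simp [symbD]

/-- Each `symbD i` raises the order by at most one; a counter run in parallel records this. -/
theorem chainSymb_support (α γ : Fin n → ℕ) (hγ : γ ∈ (chainSymb (I := I) α).support) :
    ∑ i, γ i ≤ ∑ i, α i := by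
  have count : ∀ α : Fin n → ℕ, multiIter (fun (_ : Fin n) m => m + 1) α 0 = ∑ i, α i := by
    intro α
    induction α using multiIndex_induction with
    | zero => simp
    | add α i ih =>
      rw [multiIter_add_single (fun _ _ _ => rfl), ih]
      simp [Finset.sum_add_distrib]
  have key := multiIter_rel (D := fun i => (symbD i : Symb n I → Symb n I))
    (E := fun _ m => m + 1) (r := fun M m => M ∈ Finsupp.supported _ ℝ {γ | ∑ i, γ i ≤ m})
    (x := Finsupp.single 0 1) (y := 0) ?_ α ?_
  · rw [count] at key
    exact key hγ
  · intro i M m hM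
    rw [← Finsupp.sum_single M, Finsupp.sum, map_sum]
    refine Submodule.sum_mem _ fun γ hγ => ?_
    have hγ' : ∑ i, γ i ≤ m := hM hγ
    rw [symbD_single]
    refine Submodule.add_mem _ (Finsupp.single_mem_supported _ _ ?_)
      (Submodule.sum_mem _ fun j _ => Finsupp.single_mem_supported _ _ ?_)
    · exact hγ'.trans (Nat.le_succ m)
    · simpa [Finset.sum_add_distrib] using hγ'
  · exact Finsupp.single_mem_supported _ _ (by simp)

variable {L : Type} [CommRing L] [Algebra ℝ L] {d : Fin n → Derivation ℝ L L}

/-- The value of an operator with the given symbol. -/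
def symbEval (d : Fin n → Derivation ℝ L L) (w : I ⊕ Fin n → L) (F : L) : Symb n I →ₗ[ℝ] L :=
  Finsupp.lsum ℝ fun γ => (LinearMap.mulRight ℝ
    (multiIter (fun i => nab d (w ∘ Sum.inr) i) γ F)).comp (diffHom d w).toLinearMap

theorem symbEval_apply (w : I ⊕ Fin n → L) (F : L) (M : Symb n I) :
    symbEval d w F M =
      M.sum fun γ m => diffHom d w m * multiIter (fun i => nab d (w ∘ Sum.inr) i) γ F := by
  rw [symbEval, Finsupp.lsum_apply]
  rfl

/-- The Leibniz rule for `m · nab^γ F`, with `d i` expanded as `∑ d i (g j) · nab j`, is the formula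
built into `symbD`. -/
theorem symbEval_symbD (hd : CommDer d) {w : I ⊕ Fin n → L}
    (hg : IsUnit (jac d (w ∘ Sum.inr)).det) (F : L) (i : Fin n) (M : Symb n I) :
    symbEval d w F (symbD i M) = d i (symbEval d w F M) := by
  induction M using Finsupp.induction_linear with
  | zero => simp
  | add M N hM hN => simp only [map_add, hM, hN]
  | single γ m =>
    have hX : ∀ j, multiIter (fun i => d i) (Pi.single i 1) (w (Sum.inr j)) =
        d i (w (Sum.inr j)) :=
      fun j => multiIter_single _ _ _
    simp only [symbD_single, map_add, map_sum]
    simp only [symbEval_apply, map_zero, zero_mul, Finsupp.sum_single_index, map_mul, diffHom_X,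
      diffHom_polyD hd, hX, Derivation.leibniz, smul_eq_mul]
    rw [eq_sum_nab hg i (multiIter _ _ _), add_comm, Finset.mul_sum, mul_comm (d i _)]
    congr 1
    refine Finset.sum_congr rfl fun j _ => ?_
    rw [multiIter_add_single (D := fun i => nab d (w ∘ Sum.inr) i) (nab_comm hd hg), mul_assoc]
    rfl

/-- The iterated derivatives in terms of the derivatives in a frame. -/
theorem multiIter_eq_symbEval (hd : CommDer d) {w : I ⊕ Fin n → L}
    (hg : IsUnit (jac d (w ∘ Sum.inr)).det) (α : Fin n → ℕ) (F : L) :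
    multiIter (fun i => d i) α F = symbEval d w F (chainSymb α) := by
  rw [chainSymb, multiIter_semiconj (E := fun i => d i) (symbEval_symbD hd hg F), symbEval_apply]
  simp

variable {k : ℕ}

/-- The unknowns: the coefficients of an operator and a frame. -/
abbrev GVar (n k : ℕ) : Type := Idx n k ⊕ Fin n

/-- The coefficients of the operator in the frame. -/
def frameCoeff (γ : Idx n k) : DPoly n (GVar n k) :=
  ∑ α : Idx n k, MvPolynomial.X (Sum.inl α, 0) * chainSymb α.entries γ.entries

/-- The operator `∑ u^α d^α`. -/
def opApply (d : Fin n → Derivation ℝ L L) (u : Idx n k → L) (F : L) : L :=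
  ∑ α : Idx n k, u α * multiIter (fun i => d i) α.entries F

/-- The universal chain rule, summed over `α`. The order bound on `chainSymb` ensures that only
indices of length at most `k` occur. -/
theorem opApply_eq_frame (hd : CommDer d) {w : GVar n k → L}
    (hg : IsUnit (jac d (w ∘ Sum.inr)).det) (F : L) :
    opApply d (w ∘ Sum.inl) F =
      opApply (nab d (w ∘ Sum.inr)) (fun γ => diffHom d w (frameCoeff γ)) F := by
  have h : ∀ α : Idx n k, multiIter (fun i => d i) α.entries F = ∑ γ : Idx n k,
      diffHom d w (chainSymb α.entries γ.entries) *
        multiIter (fun i => nab d (w ∘ Sum.inr) i) γ.entries F := by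
    intro α
    rw [multiIter_eq_symbEval hd hg, symbEval_apply,
      Finsupp.sum_of_support_subset (s := Finset.univ.image (Idx.entries : Idx n k → _)),
      Finset.sum_image Idx.entries_injective.injOn]
    · intro γ hγ
      exact Finset.mem_image.mpr
        ⟨Idx.mk' γ ((chainSymb_support _ _ hγ).trans α.sum_entries_le), Finset.mem_univ _, rfl⟩
    · simp
  simp only [opApply, h, frameCoeff, map_sum, map_mul, diffHom_X, multiIter_zero, Finset.mul_sum,
    Finset.sum_mul]
  rw [Finset.sum_comm]
  simp only [Function.comp_apply, mul_assoc]

/-- The jet of the operator in the frame. -/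
def frameJet (d : Fin n → Derivation ℝ L L) (w : GVar n k → L) (v : JetVar n k) : L :=
  multiIter (fun i => nab d (w ∘ Sum.inr) i) v.2 (diffHom d w (frameCoeff v.1))

/-- The coefficients in a frame are determined by the values on the monomials. -/
theorem frameCoeff_unique (hd : CommDer d) {w : GVar n k → L}
    (hg : IsUnit (jac d (w ∘ Sum.inr)).det) (c : Idx n k → L)
    (h : ∀ γ : Idx n k, opApply d (w ∘ Sum.inl) (∏ i, w (Sum.inr i) ^ γ.entries i) =
      opApply (nab d (w ∘ Sum.inr)) c (∏ i, w (Sum.inr i) ^ γ.entries i)) (γ : Idx n k) :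
    c γ = diffHom d w (frameCoeff γ) := by
  rw [← sub_eq_zero]
  refine coeff_mem (g := w ∘ Sum.inr) hg ⊥ (by simp) (fun γ => c γ - diffHom d w (frameCoeff γ)) ?_ γ
  intro γ
  have h := h γ
  rw [opApply_eq_frame hd hg] at h
  simp only [sub_mul, Finset.sum_sub_distrib, Submodule.mem_bot]
  exact sub_eq_zero.mpr h.symm

/-- Solving the triangular system for the coefficients uses only operations available in `T`. It is
applied below with `T` a subfield containing the frame. -/
theorem frameCoeff_mem (hd : CommDer d) {w : GVar n k → L}
    (hg : IsUnit (jac d (w ∘ Sum.inr)).det) (T : Submodule ℝ L)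
    (hT : ∀ i, ∀ x ∈ T, x * w (Sum.inr i) ∈ T)
    (h : ∀ γ : Idx n k, opApply d (w ∘ Sum.inl) (∏ i, w (Sum.inr i) ^ γ.entries i) ∈ T)
    (γ : Idx n k) : diffHom d w (frameCoeff γ) ∈ T := by
  refine coeff_mem (g := w ∘ Sum.inr) hg T hT (fun γ => diffHom d w (frameCoeff γ)) ?_ γ
  intro γ
  have h := h γ
  rwa [opApply_eq_frame hd hg] at h

end ChainRule

/-! ### Specialization of rational functions -/

section Special

variable {n : ℕ} {I : Type} {L : Type} [CommRing L] [Algebra ℝ L]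

/-- The graph of the extension of `f` to the fractions whose denominators become units. -/
def specGraph [Nontrivial L] (f : DPoly n I →ₐ[ℝ] L) : Subalgebra ℝ (DField n I × L) where
  carrier := {x | ∃ N Q : DPoly n I, IsUnit (f Q) ∧ x.1 * algebraMap _ _ Q = algebraMap _ _ N ∧
    x.2 * f Q = f N}
  mul_mem' := by
    rintro ⟨s, t⟩ ⟨s', t'⟩ ⟨N, Q, hQ, h1, h2⟩ ⟨N', Q', hQ', h1', h2'⟩
    refine ⟨N * N', Q * Q', by simpa using ⟨hQ, hQ'⟩, ?_, ?_⟩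
    · simp only [map_mul, ← h1, ← h1', Prod.fst_mul]
      ring
    · simp only [map_mul, ← h2, ← h2', Prod.snd_mul]
      ring
  add_mem' := by
    rintro ⟨s, t⟩ ⟨s', t'⟩ ⟨N, Q, hQ, h1, h2⟩ ⟨N', Q', hQ', h1', h2'⟩
    refine ⟨N * Q' + N' * Q, Q * Q', by simpa using ⟨hQ, hQ'⟩, ?_, ?_⟩
    · simp only [map_mul, map_add, ← h1, ← h1', Prod.fst_add]
      ring
    · simp only [map_mul, map_add, ← h2, ← h2', Prod.snd_add]
      ring
  algebraMap_mem' := by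
    intro r
    refine ⟨algebraMap _ _ r, 1, by simp, ?_, ?_⟩
    · rw [map_one, mul_one, ← IsScalarTower.algebraMap_apply]
      rfl
    · rw [map_one, mul_one, AlgHom.commutes]
      rfl

variable [Nontrivial L] {f : DPoly n I →ₐ[ℝ] L}

theorem specGraph_algebraMap (P : DPoly n I) :
    ((algebraMap _ (DField n I) P, f P) : DField n I × L) ∈ specGraph f :=
  ⟨P, 1, by simp, by simp, by simp⟩

/-- The fraction `N / Q` is arbitrary here: `f Q` may be a non-unit, since only the fraction
witnessing membership needs a unit denominator. This gives single-valuedness, and it allows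
denominators to be cleared without controlling them. -/
theorem specGraph_mul_eq {s : DField n I} {t : L} (h : (s, t) ∈ specGraph f) {N Q : DPoly n I}
    (hs : s * algebraMap _ _ Q = algebraMap _ _ N) : t * f Q = f N := by
  obtain ⟨N', Q', hQ', h1, h2⟩ := h
  have e : N * Q' = N' * Q := by
    apply IsFractionRing.injective (DPoly n I) (DField n I)
    simp only [map_mul, ← hs, ← h1]
    ring
  apply hQ'.mul_left_injective
  have := congrArg f e
  simp only [map_mul] at this
  change t * f Q * f Q' = f N * f Q'
  rw [this, ← h2]
  ring

theorem specGraph_zero {t : L} (h : ((0 : DField n I), t) ∈ specGraph f) : t = 0 := by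
  simpa using specGraph_mul_eq h (N := 0) (Q := 1) (by simp)

theorem ne_zero_of_specGraph {s : DField n I} {t : L} (h : (s, t) ∈ specGraph f) (ht : t ≠ 0) :
    s ≠ 0 := by
  rintro rfl
  exact ht (specGraph_zero h)

theorem specGraph_inv {s : DField n I} {t : L} (h : (s, t) ∈ specGraph f) (ht : IsUnit t) :
    (s⁻¹, Ring.inverse t) ∈ specGraph f := by
  have hs := ne_zero_of_specGraph h ht.ne_zero
  obtain ⟨N, Q, hQ, h1, h2⟩ := h
  simp only at h1 h2
  refine ⟨Q, N, h2 ▸ ht.mul hQ, ?_, ?_⟩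
  · rw [← h1, inv_mul_cancel_left₀ hs]
  · simp only
    rw [← h2, Ring.inverse_mul_cancel_left _ _ ht]

theorem specGraph_derivation {d : Fin n → Derivation ℝ L L}
    (hf : ∀ i P, f (polyD i P) = d i (f P)) {s : DField n I} {t : L} (h : (s, t) ∈ specGraph f)
    (i : Fin n) : (fieldD i s, d i t) ∈ specGraph f := by
  obtain ⟨N, Q, hQ, h1, h2⟩ := h
  simp only at h1 h2
  have e1 := congrArg (fieldD i) h1
  have e2 := congrArg (d i) h2
  simp only [Derivation.leibniz, smul_eq_mul, fieldD_algebraMap] at e1 e2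
  refine ⟨polyD i N * Q - N * polyD i Q, Q ^ 2, by simpa using hQ.pow 2, ?_, ?_⟩
  · simp only [map_sub, map_mul, map_pow, ← e1, ← h1]
    ring
  · simp only [map_sub, map_mul, map_pow, hf]
    rw [← e2, ← h2]
    ring

/-- A matrix of pairs is a matrix over the subalgebra, so determinants and adjugates are compatible
with both projections. For the inverse only the determinant must be inverted. -/
theorem specGraph_matrix {M : Matrix (Fin n) (Fin n) (DField n I)} {M' : Matrix (Fin n) (Fin n) L}
    (h : ∀ i j, (M i j, M' i j) ∈ specGraph f) :
    (M.det, M'.det) ∈ specGraph f ∧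
      (IsUnit M'.det → ∀ i j, (M⁻¹ i j, M'⁻¹ i j) ∈ specGraph f) := by
  let T : Matrix (Fin n) (Fin n) (specGraph f) := Matrix.of fun i j => ⟨_, h i j⟩
  let p : specGraph f →+* DField n I := (RingHom.fst _ _).comp (specGraph f).val.toRingHom
  let q : specGraph f →+* L := (RingHom.snd _ _).comp (specGraph f).val.toRingHom
  have hM : p.mapMatrix T = M := rfl
  have hM' : q.mapMatrix T = M' := rfl
  have hdet : (M.det, M'.det) = (T.det : DField n I × L) := by
    rw [← hM, ← hM', ← RingHom.map_det, ← RingHom.map_det]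
    rfl
  have hmem : (M.det, M'.det) ∈ specGraph f := hdet ▸ T.det.2
  refine ⟨hmem, fun hu i j => ?_⟩
  have hadj : (M.adjugate i j, M'.adjugate i j) = (T.adjugate i j : DField n I × L) := by
    rw [← hM, ← hM', ← RingHom.map_adjugate, ← RingHom.map_adjugate]
    rfl
  have := (specGraph f).mul_mem (specGraph_inv hmem hu) (hadj ▸ (T.adjugate i j).2)
  rw [Matrix.inv_def, Matrix.inv_def, Matrix.smul_apply, Matrix.smul_apply, Ring.inverse_eq_inv']
  exact this

theorem specGraph_jac {d : Fin n → Derivation ℝ L L} (hf : ∀ i P, f (polyD i P) = d i (f P))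
    {g : Fin n → DField n I} {g' : Fin n → L} (hg : ∀ l, (g l, g' l) ∈ specGraph f) (l i : Fin n) :
    (jac fieldD g l i, jac d g' l i) ∈ specGraph f :=
  specGraph_derivation hf (hg l) i

theorem specGraph_nab {d : Fin n → Derivation ℝ L L} (hf : ∀ i P, f (polyD i P) = d i (f P))
    {g : Fin n → DField n I} {g' : Fin n → L} (hg : ∀ l, (g l, g' l) ∈ specGraph f)
    (hu : IsUnit (jac d g').det) (j : Fin n) {s : DField n I} {t : L}
    (h : (s, t) ∈ specGraph f) : (nab fieldD g j s, nab d g' j t) ∈ specGraph f := by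
  have : ((nab fieldD g j s, nab d g' j t) : DField n I × L) =
      ∑ i, ((jac fieldD g)⁻¹ i j, (jac d g')⁻¹ i j) * (fieldD i s, d i t) := by
    ext
    · simp [nab_apply, Prod.fst_sum]
    · simp [nab_apply, Prod.snd_sum]
  rw [this]
  exact Subalgebra.sum_mem _ fun i _ => Subalgebra.mul_mem _
    ((specGraph_matrix (specGraph_jac hf hg)).2 hu i j) (specGraph_derivation hf h i)

theorem specGraph_aeval {J : Type} {x : J → DField n I} {y : J → L}
    (h : ∀ v, (x v, y v) ∈ specGraph f) (P : MvPolynomial J ℝ) :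
    (MvPolynomial.aeval x P, MvPolynomial.aeval y P) ∈ specGraph f := by
  induction P using MvPolynomial.induction_on with
  | C r =>
    rw [MvPolynomial.aeval_C, MvPolynomial.aeval_C]
    exact (specGraph f).algebraMap_mem r
  | add P Q hP hQ =>
    rw [map_add, map_add]
    exact (specGraph f).add_mem hP hQ
  | mul_X P v hP =>
    rw [map_mul, map_mul, MvPolynomial.aeval_X, MvPolynomial.aeval_X]
    exact (specGraph f).mul_mem hP (h v)

/-- Specialization of differential polynomials. -/
theorem specGraph_diffHom {d : Fin n → Derivation ℝ L L}
    (hf : ∀ i P, f (polyD i P) = d i (f P)) {ι : Type} {w : ι → DField n I} {wL : ι → L}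
    (hw : ∀ i, (w i, wL i) ∈ specGraph f) (N : DPoly n ι) :
    (diffHom fieldD w N, diffHom d wL N) ∈ specGraph f := by
  unfold diffHom
  refine specGraph_aeval (fun v => ?_) N
  exact multiIter_rel (r := fun s t => (s, t) ∈ specGraph f)
    (fun i _ _ hst => specGraph_derivation hf hst i) v.2 (hw v.1)

end Special


/-! ### The ring of smooth functions on an open set -/

section SmoothRing

variable {n : ℕ}

/-- The Euclidean space of dimension `n`. -/
abbrev Euc (n : ℕ) : Type := EuclideanSpace ℝ (Fin n)

theorem ContDiffOn.partialD {f : Euc n → ℝ} {U : Set (Euc n)} (hU : IsOpen U)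
    (hf : ContDiffOn ℝ ∞ f U) (i : Fin n) : ContDiffOn ℝ ∞ (ScalarDiffOp.partialD i f) U :=
  (hf.fderiv_of_isOpen hU (by simp)).clm_apply contDiffOn_const

theorem partialD_congr {f g : Euc n → ℝ} {U : Set (Euc n)} (hU : IsOpen U) (h : Set.EqOn f g U)
    (i : Fin n) : Set.EqOn (partialD i f) (partialD i g) U := by
  intro z hz
  have : f =ᶠ[𝓝 z] g := Filter.eventuallyEq_of_mem (hU.mem_nhds hz) h
  simp only [partialD, this.fderiv_eq]

variable {U : TopologicalSpace.Opens (Euc n)}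

/-- The smooth real functions on the open set `U`. -/
def smoothFun (U : TopologicalSpace.Opens (Euc n)) : Subalgebra ℝ (U → ℝ) where
  carrier := {h | ∃ f : Euc n → ℝ, ContDiffOn ℝ ∞ f U ∧ ∀ z : U, h z = f z}
  mul_mem' := by
    rintro a b ⟨f, hf, hf'⟩ ⟨g, hg, hg'⟩
    exact ⟨fun z => f z * g z, hf.mul hg, fun z => by simp [hf', hg']⟩
  add_mem' := by
    rintro a b ⟨f, hf, hf'⟩ ⟨g, hg, hg'⟩
    exact ⟨fun z => f z + g z, hf.add hg, fun z => by simp [hf', hg']⟩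
  algebraMap_mem' := fun r => ⟨fun _ => r, contDiffOn_const, fun _ => rfl⟩

/-- The ring of smooth real functions on the open set `U`. -/
def Smooth (U : TopologicalSpace.Opens (Euc n)) : Type := smoothFun U

instance : CommRing (Smooth U) := inferInstanceAs (CommRing (smoothFun U))

instance : Algebra ℝ (Smooth U) := inferInstanceAs (Algebra ℝ (smoothFun U))

/-- The function `f` on the ambient space restricts to `h`. -/
def Restr (h : Smooth U) (f : Euc n → ℝ) : Prop :=
  ContDiffOn ℝ ∞ f U ∧ ∀ z : U, h.1 z = f z

/-- The restriction of a smooth function. -/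
def restr (f : Euc n → ℝ) (hf : ContDiffOn ℝ ∞ f U) : Smooth U :=
  ⟨fun z => f z, f, hf, fun _ => rfl⟩

theorem restr_spec (f : Euc n → ℝ) (hf : ContDiffOn ℝ ∞ f U) : Restr (restr f hf) f :=
  ⟨hf, fun _ => rfl⟩

theorem exists_restr (h : Smooth U) : ∃ f, Restr h f := h.2

theorem Restr.unique {h h' : Smooth U} {f : Euc n → ℝ} (hf : Restr h f) (hf' : Restr h' f) :
    h = h' :=
  Subtype.ext (funext fun z => (hf.2 z).trans (hf'.2 z).symm)

theorem Restr.congr {h : Smooth U} {f g : Euc n → ℝ} (hf : Restr h f) (hg : Set.EqOn g f U) :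
    Restr h g :=
  ⟨hf.1.congr hg, fun z => (hf.2 z).trans (hg z.2).symm⟩

theorem Restr.eqOn {h : Smooth U} {f g : Euc n → ℝ} (hf : Restr h f) (hg : Restr h g) :
    Set.EqOn f g U := fun z hz => (hf.2 ⟨z, hz⟩).symm.trans (hg.2 ⟨z, hz⟩)

theorem Restr.mul {h h' : Smooth U} {f g : Euc n → ℝ} (hf : Restr h f) (hg : Restr h' g) :
    Restr (h * h') fun z => f z * g z :=
  ⟨hf.1.mul hg.1, fun z => congrArg₂ (· * ·) (hf.2 z) (hg.2 z)⟩

theorem Restr.add {h h' : Smooth U} {f g : Euc n → ℝ} (hf : Restr h f) (hg : Restr h' g) :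
    Restr (h + h') fun z => f z + g z :=
  ⟨hf.1.add hg.1, fun z => congrArg₂ (· + ·) (hf.2 z) (hg.2 z)⟩

theorem Restr.const (r : ℝ) : Restr (algebraMap ℝ (Smooth U) r) fun _ => r :=
  ⟨contDiffOn_const, fun _ => rfl⟩

/-- The partial derivative of a smooth function. -/
def smoothPartial (i : Fin n) (h : Smooth U) : Smooth U :=
  restr (partialD i (exists_restr h).choose)
    (ContDiffOn.partialD U.2 (exists_restr h).choose_spec.1 i)

/-- On an open set the derivative depends only on the restriction, so the extension chosen in
`smoothPartial` is immaterial. -/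
theorem Restr.smoothPartial {h : Smooth U} {f : Euc n → ℝ} (hf : Restr h f) (i : Fin n) :
    Restr (smoothPartial i h) (ScalarDiffOp.partialD i f) :=
  (restr_spec _ _).congr (partialD_congr U.2 (hf.eqOn (exists_restr h).choose_spec) i)

theorem Restr.differentiableAt {h : Smooth U} {f : Euc n → ℝ} (hf : Restr h f) {z : Euc n}
    (hz : z ∈ U) : DifferentiableAt ℝ f z :=
  (hf.1.contDiffAt (U.2.mem_nhds hz)).differentiableAt (by simp)

/-- The partial derivatives as derivations of the ring of smooth functions. -/
def pd (i : Fin n) : Derivation ℝ (Smooth U) (Smooth U) :=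
  Derivation.mk'
    { toFun := smoothPartial i
      map_add' := by
        intro a b
        obtain ⟨f, hf⟩ := exists_restr a
        obtain ⟨g, hg⟩ := exists_restr b
        refine ((hf.add hg).smoothPartial i).unique
          (((hf.smoothPartial i).add (hg.smoothPartial i)).congr ?_)
        intro z hz
        simp [partialD, fderiv_fun_add (hf.differentiableAt hz) (hg.differentiableAt hz)]
      map_smul' := by
        intro r a
        obtain ⟨f, hf⟩ := exists_restr a
        rw [RingHom.id_apply, Algebra.smul_def, Algebra.smul_def]
        refine (((Restr.const r).mul hf).smoothPartial i).unique
          (((Restr.const r).mul (hf.smoothPartial i)).congr ?_)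
        intro z hz
        simp [partialD, fderiv_const_mul (hf.differentiableAt hz)] }
    (by
      intro a b
      obtain ⟨f, hf⟩ := exists_restr a
      obtain ⟨g, hg⟩ := exists_restr b
      rw [smul_eq_mul, smul_eq_mul]
      refine ((hf.mul hg).smoothPartial i).unique
        (((hf.mul (hg.smoothPartial i)).add (hg.mul (hf.smoothPartial i))).congr ?_)
      intro z hz
      simp [partialD, fderiv_fun_mul (hf.differentiableAt hz) (hg.differentiableAt hz)])

theorem Restr.pd {h : Smooth U} {f : Euc n → ℝ} (hf : Restr h f) (i : Fin n) :
    Restr (pd i h) (ScalarDiffOp.partialD i f) := hf.smoothPartial i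

theorem Restr.multiIter {h : Smooth U} {f : Euc n → ℝ} (hf : Restr h f) (σ : Fin n → ℕ) :
    Restr (multiIter (fun i => ScalarDiffOp.pd i) σ h) (ScalarDiffOp.multiIter partialD σ f) :=
  multiIter_rel (r := Restr) (fun i _ _ h => h.pd i) σ hf

theorem commDer_pd : CommDer (pd : Fin n → Derivation ℝ (Smooth U) (Smooth U)) := by
  intro i j h
  obtain ⟨f, hf⟩ := exists_restr h
  refine ((hf.pd j).pd i).unique (((hf.pd i).pd j).congr ?_)
  intro z hz
  have hc : ContDiffAt ℝ ∞ f z := hf.1.contDiffAt (U.2.mem_nhds hz)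
  have hd : DifferentiableAt ℝ (fderiv ℝ f) z :=
    ((hf.1.fderiv_of_isOpen U.2 (m := ∞) (by simp)).contDiffAt
      (U.2.mem_nhds hz)).differentiableAt (by simp)
  have key : ∀ i j : Fin n, partialD i (partialD j f) z =
      fderiv ℝ (fderiv ℝ f) z (EuclideanSpace.single i 1) (EuclideanSpace.single j 1) := by
    intro i j
    unfold partialD
    rw [fderiv_clm_apply hd (differentiableAt_const _)]
    simp
  rw [key, key]
  refine (hc.isSymmSndFDerivAt ?_).eq _ _
  rw [minSmoothness_of_isRCLikeNormedField]
  exact WithTop.coe_le_coe.mpr le_top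

theorem isUnit_smoothFun {h : Smooth U} (hh : ∀ z : U, h.1 z ≠ 0) : IsUnit h := by
  obtain ⟨f, hf⟩ := exists_restr h
  have hne : ∀ z ∈ (U : Set (Euc n)), f z ≠ 0 := fun z hz => hf.2 ⟨z, hz⟩ ▸ hh ⟨z, hz⟩
  refine IsUnit.of_mul_eq_one (restr (fun z => (f z)⁻¹) (hf.1.inv hne)) ?_
  refine (hf.mul (restr_spec _ _)).unique (((Restr.const 1).congr ?_))
  exact fun z hz => mul_inv_cancel₀ (hne z hz)

/-- The evaluation at a point. -/
def evalAt (z : U) : Smooth U →ₐ[ℝ] ℝ :=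
  (Pi.evalAlgHom ℝ (fun _ : U => ℝ) z).comp (smoothFun U).val

theorem Restr.evalAt {h : Smooth U} {f : Euc n → ℝ} (hf : Restr h f) (z : U) :
    evalAt z h = f z := hf.2 z

theorem smoothFun_ext {h h' : Smooth U} (H : ∀ z : U, evalAt z h = evalAt z h') : h = h' :=
  Subtype.ext (funext H)

theorem nontrivial_smoothFun (z : U) : Nontrivial (Smooth U) :=
  (evalAt z).toRingHom.domain_nontrivial

/-- The jets of a family of functions at a point. -/
def jets {I : Type} (w : I → Euc n → ℝ) (z : Euc n) : I × (Fin n → ℕ) → ℝ :=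
  fun v => multiIter partialD v.2 (w v.1) z

theorem evalAt_diffHom {I : Type} {w : I → Smooth U} {w' : I → Euc n → ℝ}
    (hw : ∀ i, Restr (w i) (w' i)) (z : U) (P : DPoly n I) :
    evalAt z (diffHom pd w P) = P.eval (jets w' z) := by
  induction P using MvPolynomial.induction_on with
  | C r =>
    rw [← MvPolynomial.algebraMap_eq, AlgHom.commutes, AlgHom.commutes]
    simp
  | add P Q hP hQ => simp only [map_add, hP, hQ]
  | mul_X P v hP =>
    rw [map_mul, map_mul, hP, diffHom_X, map_mul, MvPolynomial.eval_X,
      ((hw v.1).multiIter v.2).evalAt]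
    rfl

/-! #### The chain rule -/

theorem fderiv_apply_eq_sum {f : Euc n → ℝ} {z : Euc n} (v : Euc n) :
    fderiv ℝ f z v = ∑ l, v l * partialD l f z := by
  have hv : v = ∑ l, v l • EuclideanSpace.single l (1 : ℝ) := by
    ext j
    simp [Pi.single_apply]
  conv_lhs => rw [hv]
  simp [partialD]

theorem partialD_comp {f : Euc n → ℝ} {ψ : Euc n → Euc n} {z : Euc n}
    (hf : DifferentiableAt ℝ f (ψ z)) (hψ : DifferentiableAt ℝ ψ z) (i : Fin n) :
    partialD i (f ∘ ψ) z = ∑ l, partialD i (fun z => ψ z l) z * partialD l f (ψ z) := by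
  rw [partialD, fderiv_comp z hf hψ, ContinuousLinearMap.comp_apply, fderiv_apply_eq_sum]
  refine Finset.sum_congr rfl fun l _ => ?_
  congr 1
  have : (fun z => ψ z l) = (EuclideanSpace.proj (𝕜 := ℝ) l) ∘ ψ := rfl
  rw [partialD, this, fderiv_comp z (ContinuousLinearMap.differentiableAt _) hψ,
    ContinuousLinearMap.fderiv]
  rfl

/-- Applying the inverse Jacobian solves the linear system. This uniqueness identifies derivatives
in a frame. -/
theorem nab_eq_of_eq_sum {L : Type} [CommRing L] [Algebra ℝ L] {d : Fin n → Derivation ℝ L L}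
    {g : Fin n → L} (hg : IsUnit (jac d g).det) {h : L} {k : Fin n → L}
    (H : ∀ i, d i h = ∑ l, d i (g l) * k l) (j : Fin n) : nab d g j h = k j := by
  have : nab d g j h = ∑ l, nab d g j (g l) * k l := by
    simp only [nab_apply, H, Finset.mul_sum, Finset.sum_mul]
    rw [Finset.sum_comm]
    simp only [mul_assoc]
  rw [this]
  simp [nab_coord hg]

/-- The frame given by a map `ψ`, up to constants. -/
structure IsFrameOf (g : Fin n → Smooth U) (ψ : Euc n → Euc n) (t : Fin n → ℝ) : Prop where
  contDiffOn : ContDiffOn ℝ ∞ ψ U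
  isUnit : IsUnit (jac pd g).det
  restr : ∀ l, Restr (g l) fun z => ψ z l + t l

/-- The chain rule exhibits the functions `∂_l f ∘ ψ` as the solution of the linear system
characterizing the derivatives in the frame. The constants `t` disappear on differentiation. -/
theorem IsFrameOf.nab {g : Fin n → Smooth U} {ψ : Euc n → Euc n} {t : Fin n → ℝ}
    (hg : IsFrameOf g ψ t) {W : Set (Euc n)} (hW : IsOpen W) (hUW : Set.MapsTo ψ U W)
    {f : Euc n → ℝ} (hf : ContDiffOn ℝ ∞ f W) {h : Smooth U} (hh : Restr h (f ∘ ψ))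
    (j : Fin n) : Restr (nab pd g j h) (partialD j f ∘ ψ) := by
  have hk : ∀ l, ContDiffOn ℝ ∞ (partialD l f ∘ ψ) U := fun l =>
    (ContDiffOn.partialD hW hf l).comp hg.contDiffOn hUW
  rw [nab_eq_of_eq_sum hg.isUnit (k := fun l => ScalarDiffOp.restr _ (hk l))]
  · exact restr_spec _ _
  · intro i
    apply smoothFun_ext
    intro z
    rw [(hh.pd i).evalAt, map_sum, partialD_comp
      ((hf.contDiffAt (hW.mem_nhds (hUW z.2))).differentiableAt (by simp))
      ((hg.contDiffOn.contDiffAt (U.2.mem_nhds z.2)).differentiableAt (by simp))]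
    refine Finset.sum_congr rfl fun l _ => ?_
    rw [map_mul, ((hg.restr l).pd i).evalAt, (restr_spec _ (hk l)).evalAt]
    simp [partialD, fderiv_add_const]

theorem IsFrameOf.multiIter {g : Fin n → Smooth U} {ψ : Euc n → Euc n} {t : Fin n → ℝ}
    (hg : IsFrameOf g ψ t) {W : Set (Euc n)} (hW : IsOpen W) (hUW : Set.MapsTo ψ U W)
    {f : Euc n → ℝ} (hf : ContDiffOn ℝ ∞ f W) {h : Smooth U} (hh : Restr h (f ∘ ψ))
    (σ : Fin n → ℕ) :
    Restr (multiIter (fun j => ScalarDiffOp.nab pd g j) σ h) (multiIter partialD σ f ∘ ψ) :=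
  (multiIter_rel (r := fun h f => ContDiffOn ℝ ∞ f W ∧ Restr h (f ∘ ψ))
    (fun i _ _ H => ⟨ContDiffOn.partialD hW H.1 i, hg.nab hW hUW H.1 H.2 i⟩) σ ⟨hf, hh⟩).2

end SmoothRing


/-! ### Polynomial functions with given jets -/

section PolyFun

variable {n : ℕ}

/-- The function defined by a polynomial. -/
def polyFun (p : MvPolynomial (Fin n) ℝ) : Euc n → ℝ := fun z => p.eval fun i => z i

theorem hasFDerivAt_polyFun (p : MvPolynomial (Fin n) ℝ) (z : Euc n) :
    ∃ f' : Euc n →L[ℝ] ℝ, HasFDerivAt (polyFun p) f' z ∧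
      ∀ j, f' (EuclideanSpace.single j 1) = polyFun (MvPolynomial.pderiv j p) z := by
  induction p using MvPolynomial.induction_on with
  | C r =>
    refine ⟨0, ?_, by simp [polyFun]⟩
    have : polyFun (MvPolynomial.C r : MvPolynomial (Fin n) ℝ) = fun _ => r := by
      funext z
      simp [polyFun]
    rw [this]
    exact hasFDerivAt_const _ _
  | add p q hp hq =>
    obtain ⟨f', hf, hf'⟩ := hp
    obtain ⟨g', hg, hg'⟩ := hq
    refine ⟨f' + g', ?_, fun j => by simp [hf', hg', polyFun]⟩
    have : polyFun (p + q) = fun z => polyFun p z + polyFun q z := by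
      funext z
      simp [polyFun]
    rw [this]
    exact hf.add hg
  | mul_X p i hp =>
    obtain ⟨f', hf, hf'⟩ := hp
    have hX : HasFDerivAt (fun z : Euc n => z i) (EuclideanSpace.proj (𝕜 := ℝ) i) z :=
      (EuclideanSpace.proj (𝕜 := ℝ) i).hasFDerivAt
    refine ⟨polyFun p z • EuclideanSpace.proj (𝕜 := ℝ) i + z i • f', ?_, ?_⟩
    · have : polyFun (p * MvPolynomial.X i) = fun z => polyFun p z * z i := by
        funext z
        simp [polyFun]
      rw [this]
      exact hf.mul hX
    · intro j
      by_cases hij : i = j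
      · subst hij
        simp [hf', polyFun]
      · simp [hf', polyFun, hij, MvPolynomial.pderiv_X]

theorem partialD_polyFun (j : Fin n) (p : MvPolynomial (Fin n) ℝ) :
    partialD j (polyFun p) = polyFun (MvPolynomial.pderiv j p) := by
  funext z
  obtain ⟨f', hf, hf'⟩ := hasFDerivAt_polyFun p z
  rw [partialD, hf.fderiv, hf']

theorem contDiff_polyFun (p : MvPolynomial (Fin n) ℝ) : ContDiff ℝ ∞ (polyFun p) := by
  induction p using MvPolynomial.induction_on with
  | C r =>
    have : polyFun (MvPolynomial.C r : MvPolynomial (Fin n) ℝ) = fun _ => r := by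
      funext z
      simp [polyFun]
    rw [this]
    exact contDiff_const
  | add p q hp hq =>
    have : polyFun (p + q) = fun z => polyFun p z + polyFun q z := by
      funext z
      simp [polyFun]
    rw [this]
    exact hp.add hq
  | mul_X p i hp =>
    have : polyFun (p * MvPolynomial.X i) = fun z => polyFun p z * z i := by
      funext z
      simp [polyFun]
    rw [this]
    exact hp.mul (EuclideanSpace.proj (𝕜 := ℝ) i).contDiff

theorem multiIter_linear {X : Type*} [AddCommGroup X] [Module ℝ X] (D : Fin n → X →ₗ[ℝ] X)
    (σ : Fin n → ℕ) : ∃ T : X →ₗ[ℝ] X, ∀ x, T x = multiIter (fun i => D i) σ x := by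
  simp only [multiIter_eq]
  induction List.finRange n with
  | nil => exact ⟨LinearMap.id, fun _ => rfl⟩
  | cons i l ih =>
    obtain ⟨T, hT⟩ := ih
    refine ⟨(D i ^ σ i) ∘ₗ T, fun x => ?_⟩
    rw [LinearMap.comp_apply, hT, Module.End.coe_pow]
    rfl

/-- There is a polynomial with given partial derivatives at a point. -/
theorem exists_polyFun_jet (s : Finset (Fin n → ℕ)) (c : (Fin n → ℕ) → ℝ) (z : Euc n) :
    ∃ p : MvPolynomial (Fin n) ℝ, ∀ σ ∈ s, multiIter partialD σ (polyFun p) z = c σ := by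
  -- Translation taking the base point `z` to the origin; the polynomial sought is then a Taylor
  -- polynomial with coefficients `c σ / σ!`.
  let shift : MvPolynomial (Fin n) ℝ →ₐ[ℝ] MvPolynomial (Fin n) ℝ :=
    MvPolynomial.aeval fun j => MvPolynomial.X j - MvPolynomial.C (z j)
  have hshift : ∀ (j : Fin n) p, shift (MvPolynomial.pderiv j p) =
      MvPolynomial.pderiv j (shift p) := by
    intro j p
    induction p using MvPolynomial.induction_on with
    | C r => simp [shift]
    | add p q hp hq => simp only [map_add, hp, hq]
    | mul_X p i hp =>
      simp only [Derivation.leibniz, map_add, smul_eq_mul, map_mul, hp, MvPolynomial.pderiv_X,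
        Pi.single_apply]
      simp only [shift, MvPolynomial.aeval_X, map_sub, MvPolynomial.pderiv_X, MvPolynomial.pderiv_C,
        sub_zero, Pi.single_apply]
      split_ifs <;> simp
  have heval : ∀ p, polyFun (shift p) z = p.eval fun _ => 0 := by
    intro p
    simp only [polyFun, shift, ← MvPolynomial.coe_aeval_eq_eval, RingHom.coe_coe]
    rw [MvPolynomial.comp_aeval_apply]
    simp
  let m : (Fin n → ℕ) → MvPolynomial (Fin n) ℝ := fun σ =>
    MvPolynomial.monomial (Finsupp.equivFunOnFinite.symm σ) 1
  refine ⟨shift (∑ σ ∈ s, MvPolynomial.C (c σ / ∏ i, (σ i).factorial) * m σ), fun τ hτ => ?_⟩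
  have h1 : ∀ p, multiIter partialD τ (polyFun (shift p)) =
      polyFun (shift (multiIter (fun j => MvPolynomial.pderiv (R := ℝ) j) τ p)) := fun p =>
    (multiIter_semiconj (f := fun p => polyFun (shift p))
      (fun j p => by rw [partialD_polyFun, hshift]) τ p).symm
  obtain ⟨T, hT⟩ := multiIter_linear
    (fun j => (MvPolynomial.pderiv (R := ℝ) (σ := Fin n) j).toLinearMap) τ
  have hT' : ∀ p, multiIter (fun j => MvPolynomial.pderiv (R := ℝ) j) τ p = T p :=
    fun p => (hT p).symm
  rw [h1, heval, hT', map_sum, map_sum, Finset.sum_eq_single τ]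
  · rw [← MvPolynomial.smul_eq_C_mul, map_smul, ← hT', multiIter_pderiv_monomial, tsub_self]
    have hz : (Finsupp.equivFunOnFinite.symm (0 : Fin n → ℕ)) = 0 := by ext; rfl
    have hne : (∏ i, ((τ i).factorial : ℝ)) ≠ 0 :=
      Finset.prod_ne_zero_iff.mpr fun i _ => Nat.cast_ne_zero.mpr (Nat.factorial_ne_zero _)
    rw [hz, MvPolynomial.smul_eval, MvPolynomial.eval_monomial]
    simp [Nat.descFactorial_self, div_mul_cancel₀ _ hne]
  · intro σ _ hσ
    rw [← MvPolynomial.smul_eq_C_mul, map_smul, ← hT', multiIter_pderiv_monomial,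
      MvPolynomial.smul_eval, MvPolynomial.eval_monomial]
    -- Either the derivative annihilates the monomial, or a positive power of some variable survives
    -- and vanishes at the origin.
    by_cases hle : ∃ i, σ i < τ i
    · obtain ⟨i, hi⟩ := hle
      have h0 : ∏ i, ((σ i).descFactorial (τ i) : ℝ) = 0 :=
        Finset.prod_eq_zero (Finset.mem_univ i)
          (by rw [Nat.descFactorial_of_lt hi, Nat.cast_zero])
      rw [h0, zero_mul, mul_zero]
    · push Not at hle
      obtain ⟨i, hi⟩ : ∃ i, τ i < σ i := by
        by_contra! h
        exact hσ (funext fun i => le_antisymm (h i) (hle i))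
      have h0 : (Finsupp.equivFunOnFinite.symm (σ - τ)).prod (fun _ e => (0 : ℝ) ^ e) = 0 := by
        rw [Finsupp.prod_fintype _ _ (by simp)]
        exact Finset.prod_eq_zero (Finset.mem_univ i) (zero_pow (Nat.sub_ne_zero_of_lt hi))
      rw [h0, mul_zero, mul_zero]
  · exact fun h => absurd hτ h

/-- There are polynomials with given jets at a point, up to finite order. -/
theorem exists_polyFun_jets {I : Type} (s : Finset (I × (Fin n → ℕ)))
    (c : I × (Fin n → ℕ) → ℝ) (z : Euc n) :
    ∃ p : I → MvPolynomial (Fin n) ℝ, ∀ v ∈ s, jets (fun i => polyFun (p i)) z v = c v := by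
  classical
  choose p hp using fun i => exists_polyFun_jet (s.image Prod.snd) (fun σ => c (i, σ)) z
  exact ⟨p, fun v hv => hp v.1 v.2 (Finset.mem_image_of_mem _ hv)⟩

theorem eval_eq_of_jets {I : Type} {θ θ' : I × (Fin n → ℕ) → ℝ} {P : DPoly n I}
    (h : ∀ v ∈ P.vars, θ v = θ' v) : P.eval θ = P.eval θ' :=
  MvPolynomial.eval₂Hom_congr' rfl (fun v hv _ => h v hv) rfl

end PolyFun

/-! ### The inverse function theorem -/

section Inverse

variable {n : ℕ}

/-- The Jacobian matrix of a map. -/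
def jacobian (ψ : Euc n → Euc n) (z : Euc n) : Matrix (Fin n) (Fin n) ℝ :=
  Matrix.of fun l i => partialD i (fun z => ψ z l) z

theorem jacobian_eq {ψ : Euc n → Euc n} {z : Euc n} (h : DifferentiableAt ℝ ψ z) :
    jacobian ψ z = LinearMap.toMatrix (EuclideanSpace.basisFun (Fin n) ℝ).toBasis
      (EuclideanSpace.basisFun (Fin n) ℝ).toBasis (fderiv ℝ ψ z).toLinearMap := by
  ext l i
  have : (fun z => ψ z l) = (EuclideanSpace.proj (𝕜 := ℝ) l) ∘ ψ := rfl
  rw [jacobian, Matrix.of_apply, partialD, this,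
    fderiv_comp z (ContinuousLinearMap.differentiableAt _) h, ContinuousLinearMap.fderiv,
    LinearMap.toMatrix_apply]
  simp

theorem det_jacobian {ψ : Euc n → Euc n} {z : Euc n} (h : DifferentiableAt ℝ ψ z) :
    (jacobian ψ z).det = (fderiv ℝ ψ z).det := by
  rw [jacobian_eq h, LinearMap.det_toMatrix]

/-- A smooth map with invertible differential at a point is a local diffeomorphism. -/
theorem exists_local_diffeo {ψ : Euc n → Euc n} {U : Set (Euc n)} (hU : IsOpen U)
    (hψ : ContDiffOn ℝ ∞ ψ U) {z : Euc n} (hz : z ∈ U) (hdet : (jacobian ψ z).det ≠ 0) :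
    ∃ Ψ : OpenPartialHomeomorph (Euc n) (Euc n), ⇑Ψ = ψ ∧ z ∈ Ψ.source ∧ Ψ.source ⊆ U ∧
      ContDiffOn ℝ ∞ Ψ.symm Ψ.target ∧ ∀ y ∈ Ψ.source, (jacobian ψ y).det ≠ 0 := by
  have hat : ∀ y ∈ U, ContDiffAt ℝ ∞ ψ y := fun y hy => hψ.contDiffAt (hU.mem_nhds hy)
  have hdiff : ∀ y ∈ U, DifferentiableAt ℝ ψ y := fun y hy => (hat y hy).differentiableAt (by simp)
  have hder : ∀ y ∈ U, (jacobian ψ y).det ≠ 0 →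
      ∃ f' : Euc n ≃L[ℝ] Euc n, HasFDerivAt ψ (f' : Euc n →L[ℝ] Euc n) y := by
    intro y hy hy'
    rw [det_jacobian (hdiff y hy)] at hy'
    refine ⟨(fderiv ℝ ψ y).toContinuousLinearEquivOfDetNeZero hy', ?_⟩
    rw [ContinuousLinearMap.coe_toContinuousLinearEquivOfDetNeZero]
    exact (hdiff y hy).hasFDerivAt
  have hcont : ContinuousOn (fun y => (jacobian ψ y).det) U := by
    simp only [Matrix.det_apply]
    refine continuousOn_finsetSum _ fun τ _ => ContinuousOn.const_smul
      (continuousOn_finsetProd _ fun i _ => ?_) _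
    exact (ContDiffOn.partialD hU ((EuclideanSpace.proj (𝕜 := ℝ) _).contDiff.comp_contDiffOn hψ)
      _).continuousOn
  -- Restricting to this set makes the inverse smooth on the whole target, not only near `ψ z`.
  have hW : IsOpen (U ∩ {y | (jacobian ψ y).det ≠ 0}) :=
    hcont.isOpen_inter_preimage hU isOpen_ne
  obtain ⟨f', hf'⟩ := hder z hz hdet
  let Ψ := ((hat z hz).toOpenPartialHomeomorph ψ hf' (by simp)).restrOpen _ hW
  have hsource : Ψ.source ⊆ U ∩ {y | (jacobian ψ y).det ≠ 0} := fun y hy => hy.2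
  refine ⟨Ψ, rfl, ⟨(hat z hz).mem_toOpenPartialHomeomorph_source hf' _, hz, hdet⟩,
    fun y hy => (hsource hy).1, fun y hy => ?_, fun y hy => (hsource hy).2⟩
  have hy' := hsource (Ψ.map_target hy)
  obtain ⟨g', hg'⟩ := hder _ hy'.1 hy'.2
  exact (Ψ.contDiffAt_symm hy hg' (hat _ hy'.1)).contDiffWithinAt

end Inverse


/-! ### The action of the generic local diffeomorphism -/

section Generic

variable {n k : ℕ} {I : Type}

/-- The unknowns as elements of the field of differential rational functions. -/
def generic (i : I) : DField n I := algebraMap (DPoly n I) _ (MvPolynomial.X (i, 0))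

theorem multiIter_fieldD_generic (σ : Fin n → ℕ) (i : I) :
    multiIter (fun j => fieldD j) σ (generic i : DField n I) =
      algebraMap (DPoly n I) _ (MvPolynomial.X (i, σ)) := by
  induction σ using multiIndex_induction with
  | zero => rw [multiIter_zero]; rfl
  | add σ j ih =>
    rw [multiIter_add_single (D := fun j => fieldD j) fieldD_comm, ih, fieldD_algebraMap, polyD_X]

theorem diffHom_generic (P : DPoly n I) :
    diffHom fieldD (generic : I → DField n I) P = algebraMap _ _ P := by
  have : diffHom fieldD (generic : I → DField n I) = IsScalarTower.toAlgHom ℝ _ _ := by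
    apply MvPolynomial.algHom_ext
    intro v
    rw [diffHom_X, multiIter_fieldD_generic]
    rfl
  rw [this]
  rfl

section Specialize

variable {L : Type} [CommRing L] [Algebra ℝ L] [Nontrivial L] {d : Fin n → Derivation ℝ L L}

theorem specGraph_generic (w : I → L) (i : I) :
    ((generic i : DField n I), w i) ∈ specGraph (diffHom d w) := by
  have := specGraph_algebraMap (f := diffHom d w) (MvPolynomial.X (i, (0 : Fin n → ℕ)))
  rwa [diffHom_X, multiIter_zero] at this

/-- The only division in a frame jet is by the Jacobian determinant, so frame jets specialize to
every map with invertible Jacobian. -/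
theorem specGraph_frameJet (hd : CommDer d) {w : GVar n k → L}
    (hg : IsUnit (jac d (w ∘ Sum.inr)).det) (v : JetVar n k) :
    (frameJet fieldD generic v, frameJet d w v) ∈ specGraph (diffHom d w) := by
  refine multiIter_rel (r := fun s t => (s, t) ∈ specGraph (diffHom d w)) ?_ v.2 ?_
  · intro j s t h
    exact specGraph_nab (fun i P => diffHom_polyD hd w i P)
      (fun l => specGraph_generic w (Sum.inr l)) hg j h
  · rw [diffHom_generic]
    exact specGraph_algebraMap _

theorem isUnit_jac_of_specGraph {f : DPoly n I →ₐ[ℝ] L} (hf : ∀ i P, f (polyD i P) = d i (f P))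
    {g : Fin n → DField n I} {g' : Fin n → L} (hg : ∀ l, (g l, g' l) ∈ specGraph f)
    (hu : (jac d g').det ≠ 0) : IsUnit (jac fieldD g).det :=
  (ne_zero_of_specGraph (specGraph_matrix (specGraph_jac hf hg)).1 hu).isUnit

end Specialize

/-! #### The identity frame -/

/-- The coordinate functions. -/
def coordFun (U : TopologicalSpace.Opens (Euc n)) (l : Fin n) : Smooth U :=
  restr (fun z => z l) (EuclideanSpace.proj (𝕜 := ℝ) l).contDiff.contDiffOn

theorem restr_coordFun (U : TopologicalSpace.Opens (Euc n)) (l : Fin n) :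
    Restr (coordFun U l) fun z => z l :=
  restr_spec _ _

/-- The unknowns specialized to smooth functions and the identity map. -/
def idFrame (U : TopologicalSpace.Opens (Euc n)) (a : Idx n k → Smooth U) : GVar n k → Smooth U :=
  Sum.elim a (coordFun U)

theorem jac_idFrame (U : TopologicalSpace.Opens (Euc n)) (a : Idx n k → Smooth U) :
    jac pd (idFrame U a ∘ Sum.inr) = 1 := by
  ext l i
  apply smoothFun_ext
  intro z
  change evalAt z (pd i (coordFun U l)) = _
  rw [((restr_coordFun U l).pd i).evalAt, Matrix.one_apply, apply_ite (evalAt z), map_one, map_zero]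
  have : fderiv ℝ (fun z : Euc n => z l) z = EuclideanSpace.proj (𝕜 := ℝ) l :=
    (EuclideanSpace.proj (𝕜 := ℝ) l).fderiv
  rw [partialD, this]
  simp

/-- The identity frame leaves the derivations unchanged, and then the coefficients are the original
ones by uniqueness. -/
theorem frameJet_idFrame (U : TopologicalSpace.Opens (Euc n)) (a : Idx n k → Smooth U)
    (v : JetVar n k) : frameJet pd (idFrame U a) v = multiIter (fun i => pd i) v.2 (a v.1) := by
  have hu : IsUnit (jac pd (idFrame U a ∘ Sum.inr)).det := by simp [jac_idFrame]
  have hnab : nab pd (idFrame U a ∘ Sum.inr) = pd := by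
    funext j
    ext h : 1
    rw [nab_apply, jac_idFrame, inv_one]
    simp [Matrix.one_apply]
  have hc : diffHom pd (idFrame U a) (frameCoeff v.1) = a v.1 := by
    refine (frameCoeff_unique commDer_pd hu a (fun γ => ?_) v.1).symm
    rw [hnab]
    rfl
  rw [frameJet, hnab, hc]

/-- The generic map specializes to the identity, whose Jacobian determinant is 1; an element with
nonzero specialization is nonzero. -/
theorem isUnit_jac_generic :
    IsUnit (jac fieldD (generic ∘ Sum.inr : Fin n → DField n (GVar n k))).det := by
  let U : TopologicalSpace.Opens (Euc n) := ⊤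
  have : Nontrivial (Smooth U) := nontrivial_smoothFun ⟨0, trivial⟩
  refine isUnit_jac_of_specGraph (d := pd) (f := diffHom pd (idFrame U (0 : Idx n k → Smooth U)))
    (fun i P => diffHom_polyD commDer_pd _ i P)
    (fun l => specGraph_generic (idFrame U (0 : Idx n k → Smooth U)) (Sum.inr l)) ?_
  have := jac_idFrame U (0 : Idx n k → Smooth U)
  exact this ▸ by simp

/-- The substitution of the jet of the transformed operator. -/
def jetHom (n k : ℕ) : DPoly n (Idx n k) →ₐ[ℝ] DField n (GVar n k) :=
  MvPolynomial.aeval (frameJet fieldD generic)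

/-- Under specialization to the identity map, frame jets become ordinary jets. Operators with
polynomial coefficients realize any values of finitely many jet coordinates, so no nonzero
polynomial is killed. -/
theorem jetHom_injective : Function.Injective (jetHom n k) := by
  rw [injective_iff_map_eq_zero]
  intro P hP
  by_contra hne
  obtain ⟨θ, hθ⟩ : ∃ θ, P.eval θ ≠ 0 := by
    by_contra! h
    exact hne (MvPolynomial.funext fun θ => by rw [h, map_zero])
  obtain ⟨p, hp⟩ := exists_polyFun_jets P.vars θ (0 : Euc n)
  let U : TopologicalSpace.Opens (Euc n) := ⊤
  let z : U := ⟨0, trivial⟩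
  have : Nontrivial (Smooth U) := nontrivial_smoothFun z
  let a : Idx n k → Smooth U := fun α => restr (polyFun (p α)) (contDiff_polyFun _).contDiffOn
  have ha : ∀ α, Restr (a α) (polyFun (p α)) := fun α => restr_spec _ _
  have hu : IsUnit (jac pd (idFrame U a ∘ Sum.inr)).det := by simp [jac_idFrame]
  have h := specGraph_aeval (specGraph_frameJet commDer_pd hu) P
  rw [← jetHom, hP] at h
  have h0 := congrArg (evalAt z) (specGraph_zero h)
  have : MvPolynomial.aeval (frameJet pd (idFrame U a)) P = diffHom pd a P := by
    rw [funext (frameJet_idFrame U a)]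
    rfl
  rw [this, evalAt_diffHom ha, map_zero] at h0
  exact hθ ((eval_eq_of_jets fun v hv => (hp v hv).symm).trans h0)

/-- A morphism which intertwines derivations on the unknowns intertwines them. -/
theorem hom_fieldD {K : Type} [Field K] [Algebra ℝ K] (f : DField n I →ₐ[ℝ] K)
    (d : Derivation ℝ K K) (i : Fin n)
    (h : ∀ v, f (algebraMap (DPoly n I) _ (MvPolynomial.X (v.1, v.2 + Pi.single i 1))) =
      d (f (algebraMap (DPoly n I) _ (MvPolynomial.X v)))) (F : DField n I) :
    f (fieldD i F) = d (f F) := by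
  have hpoly : ∀ P : DPoly n I, f (algebraMap _ _ (polyD i P)) = d (f (algebraMap _ _ P)) := by
    intro P
    induction P using MvPolynomial.induction_on with
    | C r =>
      rw [← MvPolynomial.algebraMap_eq, Derivation.map_algebraMap,
        ← IsScalarTower.algebraMap_apply, AlgHom.commutes, Derivation.map_algebraMap, map_zero,
        map_zero]
    | add P Q hP hQ => simp only [map_add, hP, hQ]
    | mul_X P v hP =>
      simp only [Derivation.leibniz, map_add, smul_eq_mul, map_mul, hP, polyD_X, h]
  obtain ⟨P, Q, hQ, rfl⟩ := IsFractionRing.div_surjective (A := DPoly n I) F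
  set F := algebraMap (DPoly n I) (DField n I) P / algebraMap _ _ Q with hF
  have hQ' : algebraMap (DPoly n I) (DField n I) Q ≠ 0 := by
    simpa using nonZeroDivisors.ne_zero hQ
  have key : F * algebraMap _ _ Q = algebraMap (DPoly n I) (DField n I) P :=
    div_mul_cancel₀ _ hQ'
  have k1 := congrArg (fun x => f (fieldD i x)) key
  have k2 := congrArg (fun x => d (f x)) key
  simp only [Derivation.leibniz, smul_eq_mul, map_add, map_mul, fieldD_algebraMap, hpoly] at k1 k2
  have hfQ : f (algebraMap _ _ Q) ≠ 0 := (map_ne_zero f).mpr hQ'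
  apply mul_left_cancel₀ hfQ
  linear_combination k1 - k2

/-- The transformation of rational functions by the generic local diffeomorphism. -/
def pushHom (n k : ℕ) : RatFun n k →ₐ[ℝ] DField n (GVar n k) :=
  IsFractionRing.liftAlgHom (g := jetHom n k) jetHom_injective

theorem pushHom_algebraMap (P : DPoly n (Idx n k)) :
    pushHom n k (algebraMap _ _ P) = jetHom n k P :=
  IsFractionRing.lift_algebraMap (g := (jetHom n k).toRingHom) jetHom_injective P

/-- Total derivatives become derivatives along the image coordinates. On variables this is how frame
jets are built, the `nab` being commuting. -/
theorem pushHom_fieldD (i : Fin n) (F : RatFun n k) :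
    pushHom n k (fieldD i F) = nab fieldD (generic ∘ Sum.inr) i (pushHom n k F) := by
  apply hom_fieldD
  intro v
  rw [pushHom_algebraMap, pushHom_algebraMap, jetHom, MvPolynomial.aeval_X, MvPolynomial.aeval_X,
    frameJet, multiIter_add_single (D := fun i => nab fieldD (generic ∘ Sum.inr) i)
      (nab_comm commDer_fieldD isUnit_jac_generic)]
  rfl

/-- The polynomials in the jet coordinates, as polynomials in the jets of operator and map. -/
def inclPoly (n k : ℕ) : DPoly n (Idx n k) →ₐ[ℝ] DPoly n (GVar n k) :=
  MvPolynomial.rename fun v => (Sum.inl v.1, v.2)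

theorem inclPoly_injective : Function.Injective (inclPoly n k) := by
  apply MvPolynomial.rename_injective
  rintro ⟨α, σ⟩ ⟨α', σ'⟩ h
  simpa using h

/-- The inclusion of the rational functions of the operator alone. -/
def inclHom (n k : ℕ) : RatFun n k →ₐ[ℝ] DField n (GVar n k) :=
  IsFractionRing.liftAlgHom (g := (IsScalarTower.toAlgHom ℝ _ _).comp (inclPoly n k))
    ((IsFractionRing.injective (DPoly n (GVar n k)) _).comp inclPoly_injective)

theorem inclHom_algebraMap (P : DPoly n (Idx n k)) :
    inclHom n k (algebraMap _ _ P) = algebraMap _ _ (inclPoly n k P) :=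
  IsFractionRing.lift_algebraMap
    (g := ((IsScalarTower.toAlgHom ℝ _ (DField n (GVar n k))).comp (inclPoly n k)).toRingHom)
    ((IsFractionRing.injective (DPoly n (GVar n k)) _).comp inclPoly_injective) P

theorem inclHom_fieldD (i : Fin n) (F : RatFun n k) :
    inclHom n k (fieldD i F) = fieldD i (inclHom n k F) := by
  apply hom_fieldD
  intro v
  rw [inclHom_algebraMap, inclHom_algebraMap, inclPoly, MvPolynomial.rename_X,
    MvPolynomial.rename_X, fieldD_algebraMap, polyD_X]

end Generic

/-! ### Invariance is preserved by the Tresse derivatives and the universal operator -/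

section Invariance

variable {n k : ℕ}

theorem tresse_eq_nab (J : Fin n → RatFun n k) (i : Fin n) (F : RatFun n k) :
    tresse J i F = nab fieldD J i F := by
  have : (Matrix.of fun j i => totalDifferential (J i) j) = (jac fieldD J).transpose := rfl
  rw [tresse, this, ← Matrix.transpose_nonsing_inv, nab_apply, Matrix.mulVec, dotProduct]
  rfl

theorem GeneralPosition.isUnit_jac {J : Fin n → RatFun n k} (hJ : GeneralPosition J) :
    IsUnit (jac fieldD J).det := by
  have := (Matrix.isUnit_iff_isUnit_det _).mp hJ.isUnit
  rw [← Matrix.det_transpose]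
  exact this

/-- Both sides solve the system `d F = ∑ k_l d J_l` in the large field, where the Jacobian of `J`
stays invertible. For the transformed side the system first holds along the generic frame and is
carried back by the chain rule. -/
theorem pushHom_tresse {J : Fin n → RatFun n k} (hJ : GeneralPosition J)
    (hinv : ∀ i, pushHom n k (J i) = inclHom n k (J i)) {F : RatFun n k}
    (hF : pushHom n k F = inclHom n k F) (i : Fin n) :
    pushHom n k (tresse J i F) = inclHom n k (tresse J i F) := by
  rw [tresse_eq_nab]
  have hu := hJ.isUnit_jac
  have hu' : IsUnit (jac fieldD fun l => inclHom n k (J l)).det := by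
    have : jac fieldD (fun l => inclHom n k (J l)) =
        (inclHom n k).toRingHom.mapMatrix (jac fieldD J) := by
      ext l i
      exact (inclHom_fieldD i (J l)).symm
    rw [this, ← RingHom.map_det]
    exact hu.map _
  have h1 : ∀ m, fieldD m (inclHom n k F) = ∑ l, fieldD m (inclHom n k (J l)) *
      inclHom n k (nab fieldD J l F) := by
    intro m
    simp only [← inclHom_fieldD, ← map_mul, ← map_sum]
    rw [← eq_sum_nab hu]
  have h2 : ∀ m, fieldD m (inclHom n k F) = ∑ l, fieldD m (inclHom n k (J l)) *
      pushHom n k (nab fieldD J l F) := by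
    intro m
    have key : ∀ j, nab fieldD (generic ∘ Sum.inr) j (inclHom n k F) =
        ∑ l, nab fieldD (generic ∘ Sum.inr) j (inclHom n k (J l)) *
          pushHom n k (nab fieldD J l F) := by
      intro j
      simp only [← hF, ← hinv, ← pushHom_fieldD, ← map_mul, ← map_sum]
      rw [← eq_sum_nab hu]
    rw [eq_sum_nab isUnit_jac_generic m]
    simp only [key, Finset.mul_sum]
    rw [Finset.sum_comm]
    refine Finset.sum_congr rfl fun l _ => ?_
    rw [eq_sum_nab isUnit_jac_generic m (inclHom n k (J l)), Finset.sum_mul]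
    simp only [mul_assoc]
  exact (nab_eq_of_eq_sum hu' h2 i).symm.trans (nab_eq_of_eq_sum hu' h1 i)

theorem box_eq_opApply (F : RatFun n k) : box F = opApply fieldD generic F := rfl

/-- `□` applies the operator itself, and an operator acts in the same way whether written in the `d
i` or in the generic frame. -/
theorem pushHom_box {F : RatFun n k} (hF : pushHom n k F = inclHom n k F) :
    pushHom n k (box F) = inclHom n k (box F) := by
  have h1 : pushHom n k (box F) =
      opApply fieldD (generic ∘ Sum.inl) (pushHom n k F) := by
    rw [opApply_eq_frame commDer_fieldD isUnit_jac_generic, box_eq_opApply, opApply, opApply,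
      map_sum]
    refine Finset.sum_congr rfl fun α _ => ?_
    rw [map_mul, multiIter_semiconj (E := fun i => nab fieldD (generic ∘ Sum.inr) i)
      pushHom_fieldD, generic, pushHom_algebraMap, jetHom, MvPolynomial.aeval_X, frameJet,
      multiIter_zero]
  have h2 : inclHom n k (box F) = opApply fieldD (generic ∘ Sum.inl) (inclHom n k F) := by
    rw [box_eq_opApply, opApply, opApply, map_sum]
    refine Finset.sum_congr rfl fun α _ => ?_
    rw [map_mul, multiIter_semiconj (E := fun i => fieldD i) inclHom_fieldD, generic,
      inclHom_algebraMap, inclPoly, MvPolynomial.rename_X]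
    rfl
  rw [h1, h2, hF]

end Invariance


/-! ### Operators and local diffeomorphisms in a chart -/

section Chart

variable {n k : ℕ}

/-- The operator `∑ a^α ∂^α` on functions on the Euclidean space. -/
def chartOp (a : Coeffs n k) (f : Euc n → ℝ) (z : Euc n) : ℝ :=
  ∑ α, a α z * multiIter partialD α.entries f z

theorem multiIter_partialD_congr {f g : Euc n → ℝ} {z : Euc n} (h : f =ᶠ[𝓝 z] g)
    (σ : Fin n → ℕ) : multiIter partialD σ f =ᶠ[𝓝 z] multiIter partialD σ g := by
  refine multiIter_rel (r := fun f g : Euc n → ℝ => f =ᶠ[𝓝 z] g) (fun i f g h => ?_) σ h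
  filter_upwards [h.eventuallyEq_nhds] with y hy
  rw [partialD, partialD, hy.fderiv_eq]

theorem chartOp_congr (a : Coeffs n k) {f g : Euc n → ℝ} {z : Euc n} (h : f =ᶠ[𝓝 z] g) :
    chartOp a f z = chartOp a g z :=
  Finset.sum_congr rfl fun α _ => by rw [(multiIter_partialD_congr h α.entries).eq_of_nhds]

/-- `b` are the coefficients near `ψ z₀` of the push-forward by `ψ` of the operator with
coefficients `a` near `z₀`. -/
def ChartPush (ψ : Euc n → Euc n) (z₀ : Euc n) (a b : Coeffs n k) : Prop :=
  ∀ f : Euc n → ℝ, (∀ᶠ y in 𝓝 (ψ z₀), ContDiffAt ℝ ∞ f y) →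
    ∀ᶠ z in 𝓝 z₀, chartOp b f (ψ z) = chartOp a (f ∘ ψ) z

/-- A map with nonvanishing Jacobian is a frame. -/
theorem isFrameOf_restr {U : TopologicalSpace.Opens (Euc n)} {ψ : Euc n → Euc n} {t : Fin n → ℝ}
    (hψ : ContDiffOn ℝ ∞ ψ U) (hdet : ∀ z ∈ U, (jacobian ψ z).det ≠ 0) {g : Fin n → Smooth U}
    (hg : ∀ l, Restr (g l) fun z => ψ z l + t l) : IsFrameOf g ψ t where
  contDiffOn := hψ
  restr := hg
  isUnit := by
    apply isUnit_smoothFun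
    intro z
    have : (evalAt z).toRingHom.mapMatrix (jac pd g) = jacobian ψ z := by
      ext l i
      refine (((hg l).pd i).evalAt z).trans ?_
      simp [partialD, jacobian, fderiv_add_const]
    have h := hdet z z.2
    rw [← this, ← RingHom.map_det] at h
    exact h

variable {U : TopologicalSpace.Opens (Euc n)} {w : GVar n k → Smooth U}
  {w' : GVar n k → Euc n → ℝ} {ψ : Euc n → Euc n} {t : Fin n → ℝ}

theorem evalAt_opApply_pd {a : Idx n k → Smooth U} {a' : Coeffs n k} (ha : ∀ α, Restr (a α) (a' α))
    {F : Smooth U} {f : Euc n → ℝ} (hF : Restr F f) (z : U) :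
    evalAt z (opApply pd a F) = chartOp a' f z := by
  rw [opApply, chartOp, map_sum]
  refine Finset.sum_congr rfl fun α _ => ?_
  rw [map_mul, (ha α).evalAt, (hF.multiIter α.entries).evalAt]

theorem evalAt_opApply_nab {g : Fin n → Smooth U} (hg : IsFrameOf g ψ t) {W : Set (Euc n)}
    (hW : IsOpen W) (hUW : Set.MapsTo ψ U W) {c : Idx n k → Smooth U} {b : Coeffs n k} (z : U)
    (hc : ∀ γ, evalAt z (c γ) = b γ (ψ z)) {f : Euc n → ℝ} (hf : ContDiffOn ℝ ∞ f W)
    {F : Smooth U} (hF : Restr F (f ∘ ψ)) :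
    evalAt z (opApply (nab pd g) c F) = chartOp b f (ψ z) := by
  rw [opApply, chartOp, map_sum]
  refine Finset.sum_congr rfl fun α _ => ?_
  rw [map_mul, hc, (hg.multiIter hW hUW hf hF α.entries).evalAt]
  rfl

/-- The coefficients of the transformed operator. -/
theorem chartOp_comp (hw : ∀ i, Restr (w i) (w' i)) (hg : IsFrameOf (w ∘ Sum.inr) ψ t)
    {W : Set (Euc n)} (hW : IsOpen W) (hUW : Set.MapsTo ψ U W) {b : Coeffs n k} {z : Euc n}
    (hz : z ∈ U) (hb : ∀ γ, b γ (ψ z) = (frameCoeff γ).eval (jets w' z))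
    {f : Euc n → ℝ} (hf : ContDiffOn ℝ ∞ f W) :
    chartOp b f (ψ z) = chartOp (w' ∘ Sum.inl) (f ∘ ψ) z := by
  have hF := restr_spec (U := U) (f ∘ ψ) (hf.comp hg.contDiffOn hUW)
  rw [← evalAt_opApply_pd (a' := w' ∘ Sum.inl) (fun α => hw (Sum.inl α)) hF ⟨z, hz⟩,
    ← evalAt_opApply_nab hg hW hUW ⟨z, hz⟩ (c := fun γ => diffHom pd w (frameCoeff γ)) _ hf hF]
  · exact congrArg _ (opApply_eq_frame commDer_pd hg.isUnit _).symm
  · exact fun γ => (evalAt_diffHom hw ⟨z, hz⟩ _).trans (hb γ).symm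

/-- The jets of the transformed operator. -/
theorem frameJet_eq_jet (hw : ∀ i, Restr (w i) (w' i)) (hg : IsFrameOf (w ∘ Sum.inr) ψ t)
    {W : Set (Euc n)} (hW : IsOpen W) (hUW : Set.MapsTo ψ U W) {b : Coeffs n k}
    (hb : ∀ α, ContDiffOn ℝ ∞ (b α) W)
    (h : ∀ γ : Idx n k, ∀ z ∈ U, chartOp b (fun y => ∏ i, (y i + t i) ^ γ.entries i) (ψ z) =
      chartOp (w' ∘ Sum.inl) ((fun y => ∏ i, (y i + t i) ^ γ.entries i) ∘ ψ) z)
    (v : JetVar n k) (z : U) : evalAt z (frameJet pd w v) = jet b (ψ z) v := by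
  have hbr : ∀ α, Restr (restr (U := U) (b α ∘ ψ) ((hb α).comp hg.contDiffOn hUW)) (b α ∘ ψ) :=
    fun α => restr_spec _ _
  -- The coefficients are determined by the values on monomials in the frame functions `ψ_i + t_i`,
  -- which is all that `h` supplies.
  have hcoeff : ∀ γ : Idx n k, restr (b γ ∘ ψ) ((hb γ).comp hg.contDiffOn hUW) =
      diffHom pd w (frameCoeff γ) := by
    refine frameCoeff_unique commDer_pd hg.isUnit
      (fun γ => restr (b γ ∘ ψ) ((hb γ).comp hg.contDiffOn hUW)) fun γ => ?_
    have hmon : ContDiff ℝ ∞ fun y : Euc n => ∏ i, (y i + t i) ^ γ.entries i :=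
      contDiff_prod fun i _ =>
        (((EuclideanSpace.proj (𝕜 := ℝ) i).contDiff (n := ∞)).add contDiff_const).pow _
    have hF : Restr (∏ i, w (Sum.inr i) ^ γ.entries i)
        ((fun y => ∏ i, (y i + t i) ^ γ.entries i) ∘ ψ) := by
      refine ⟨hmon.comp_contDiffOn hg.contDiffOn, fun z => ?_⟩
      change evalAt z _ = _
      rw [map_prod]
      refine Finset.prod_congr rfl fun i _ => ?_
      rw [map_pow]
      exact congrArg (· ^ _) ((hg.restr i).evalAt z)
    apply smoothFun_ext
    intro z
    rw [evalAt_opApply_nab hg hW hUW (b := b) z (fun γ => (hbr γ).evalAt z) hmon.contDiffOn hF]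
    exact (evalAt_opApply_pd (fun α => hw (Sum.inl α)) hF z).trans (h γ z z.2).symm
  rw [frameJet, ← hcoeff]
  exact (hg.multiIter hW hUW (hb v.1) (hbr v.1) v.2).evalAt z

/-! #### The universal obstruction to invariance -/

/-- The numerator of the difference of `P / Q` and its transform. -/
def obstruction (P Q : DPoly n (Idx n k)) : DField n (GVar n k) :=
  jetHom n k P * algebraMap _ _ (inclPoly n k Q) - algebraMap _ _ (inclPoly n k P) * jetHom n k Q

theorem obstruction_eq_zero_iff {P Q : DPoly n (Idx n k)} (hQ : Q ≠ 0) :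
    obstruction P Q = 0 ↔
      pushHom n k (algebraMap _ _ P / algebraMap _ _ Q) =
        inclHom n k (algebraMap _ _ P / algebraMap _ _ Q) := by
  have h1 : jetHom n k Q ≠ 0 := by
    simpa using jetHom_injective.ne hQ
  have h2 : algebraMap _ (DField n (GVar n k)) (inclPoly n k Q) ≠ 0 := by
    simpa using inclPoly_injective.ne hQ
  rw [map_div₀, map_div₀, pushHom_algebraMap, pushHom_algebraMap, inclHom_algebraMap,
    inclHom_algebraMap, div_eq_div_iff h1 h2, obstruction, sub_eq_zero]

theorem diffHom_inclPoly {L : Type} [CommRing L] [Algebra ℝ L] (d : Fin n → Derivation ℝ L L)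
    (w : GVar n k → L) (P : DPoly n (Idx n k)) :
    diffHom d w (inclPoly n k P) = diffHom d (w ∘ Sum.inl) P := by
  rw [diffHom, inclPoly, MvPolynomial.aeval_rename]
  rfl

theorem specGraph_obstruction {L : Type} [CommRing L] [Algebra ℝ L] [Nontrivial L]
    {d : Fin n → Derivation ℝ L L} (hd : CommDer d) {w : GVar n k → L}
    (hg : IsUnit (jac d (w ∘ Sum.inr)).det) (P Q : DPoly n (Idx n k)) :
    (obstruction P Q, MvPolynomial.aeval (frameJet d w) P * diffHom d (w ∘ Sum.inl) Q -
      diffHom d (w ∘ Sum.inl) P * MvPolynomial.aeval (frameJet d w) Q) ∈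
        specGraph (diffHom d w) := by
  have h1 : ∀ P, (jetHom n k P, MvPolynomial.aeval (frameJet d w) P) ∈ specGraph (diffHom d w) :=
    specGraph_aeval (specGraph_frameJet hd hg)
  have h2 : ∀ P, (algebraMap _ _ (inclPoly n k P), diffHom d (w ∘ Sum.inl) P) ∈
      specGraph (diffHom d w) := fun P => by
    rw [← diffHom_inclPoly]
    exact specGraph_algebraMap _
  exact Subalgebra.sub_mem _ (Subalgebra.mul_mem _ (h1 P) (h2 Q))
    (Subalgebra.mul_mem _ (h2 P) (h1 Q))

theorem evalAt_aeval_frameJet {b : Coeffs n k} {z : U}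
    (h : ∀ v, evalAt z (frameJet pd w v) = jet b (ψ z) v) (P : DPoly n (Idx n k)) :
    evalAt z (MvPolynomial.aeval (frameJet pd w) P) = P.eval (jet b (ψ z)) := by
  rw [MvPolynomial.comp_aeval_apply, funext h]
  exact DFunLike.congr_fun (MvPolynomial.coe_aeval_eq_eval _) P

theorem evalAt_obstruction (hw : ∀ i, Restr (w i) (w' i)) {b : Coeffs n k} {z : U}
    (h : ∀ v, evalAt z (frameJet pd w v) = jet b (ψ z) v) (P Q : DPoly n (Idx n k)) :
    evalAt z (MvPolynomial.aeval (frameJet pd w) P * diffHom pd (w ∘ Sum.inl) Q -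
      diffHom pd (w ∘ Sum.inl) P * MvPolynomial.aeval (frameJet pd w) Q) =
    P.eval (jet b (ψ z)) * Q.eval (jet (w' ∘ Sum.inl) z) -
      P.eval (jet (w' ∘ Sum.inl) z) * Q.eval (jet b (ψ z)) := by
  have hj : ∀ P : DPoly n (Idx n k),
      evalAt z (diffHom pd (w ∘ Sum.inl) P) = P.eval (jet (w' ∘ Sum.inl) z) :=
    fun P => evalAt_diffHom (fun α => hw (Sum.inl α)) z P
  rw [map_sub, map_mul, map_mul, evalAt_aeval_frameJet h, evalAt_aeval_frameJet h, hj, hj]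

end Chart


/-! ### The obstruction tested on local diffeomorphisms of Euclidean space -/

section LocalDiffeo

variable {n k : ℕ}

/-- Differentiate `Ψ.symm ∘ Ψ = id` and take determinants. -/
theorem det_jacobian_ne_zero {Ψ : OpenPartialHomeomorph (Euc n) (Euc n)}
    (h : ContDiffOn ℝ ∞ Ψ Ψ.source) (h' : ContDiffOn ℝ ∞ Ψ.symm Ψ.target) {z : Euc n}
    (hz : z ∈ Ψ.source) : (jacobian Ψ z).det ≠ 0 := by
  have hd : DifferentiableAt ℝ Ψ z :=
    (h.contDiffAt (Ψ.open_source.mem_nhds hz)).differentiableAt (by simp)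
  have hd' : DifferentiableAt ℝ Ψ.symm (Ψ z) :=
    (h'.contDiffAt (Ψ.open_target.mem_nhds (Ψ.map_source hz))).differentiableAt (by simp)
  have hid : (Ψ.symm ∘ Ψ : Euc n → Euc n) =ᶠ[𝓝 z] id := by
    filter_upwards [Ψ.open_source.mem_nhds hz] with y hy using Ψ.left_inv hy
  have hcomp := hid.fderiv_eq (𝕜 := ℝ)
  rw [fderiv_comp z hd' hd, fderiv_id] at hcomp
  have hdet : LinearMap.det ((fderiv ℝ Ψ.symm (Ψ z)).toLinearMap ∘ₗ
      (fderiv ℝ Ψ z).toLinearMap) = 1 := by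
    rw [← LinearMap.det_id (M := Euc n) (A := ℝ)]
    exact congrArg (fun A : Euc n →L[ℝ] Euc n => LinearMap.det A.toLinearMap) hcomp
  rw [LinearMap.det_comp] at hdet
  rw [det_jacobian hd]
  exact right_ne_zero_of_mul_eq_one hdet

theorem Coeffs.SmoothNear.exists_isOpen {a : Coeffs n k} {z : Euc n} (ha : a.SmoothNear z) :
    ∃ W : Set (Euc n), IsOpen W ∧ z ∈ W ∧ ∀ α, ContDiffOn ℝ ∞ (a α) W := by
  obtain ⟨W, hW, hWo, hz⟩ := eventually_nhds_iff.mp (Filter.eventually_all.mpr ha)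
  exact ⟨W, hWo, hz, fun α y hy => (hW y hy α).contDiffWithinAt⟩

/-- Invariance of pairs without obstruction. -/
theorem eval_jet_of_obstruction_eq_zero {P Q : DPoly n (Idx n k)} (hPQ : obstruction P Q = 0)
    {Ψ : OpenPartialHomeomorph (Euc n) (Euc n)} (h : ContDiffOn ℝ ∞ Ψ Ψ.source)
    (h' : ContDiffOn ℝ ∞ Ψ.symm Ψ.target) {z₀ : Euc n} (hz : z₀ ∈ Ψ.source) {a b : Coeffs n k}
    (ha : a.SmoothNear z₀) (hb : b.SmoothNear (Ψ z₀)) (hab : ChartPush Ψ z₀ a b) :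
    P.eval (jet a z₀) * Q.eval (jet b (Ψ z₀)) = P.eval (jet b (Ψ z₀)) * Q.eval (jet a z₀) := by
  obtain ⟨V, hV, hzV, haV⟩ := ha.exists_isOpen
  obtain ⟨W, hW, hzW, hbW⟩ := hb.exists_isOpen
  have hmon : ∀ γ : Idx n k, ContDiff ℝ ∞ fun y : Euc n => ∏ i, (y i + (0 : ℝ)) ^ γ.entries i :=
    fun γ => contDiff_prod fun i _ =>
      (((EuclideanSpace.proj (𝕜 := ℝ) i).contDiff (n := ∞)).add contDiff_const).pow _
  -- Finitely many monomials determine the coefficients, so one neighbourhood serves for all test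
  -- functions.
  obtain ⟨X, hX, hXo, hzX⟩ := eventually_nhds_iff.mp (Filter.eventually_all.mpr fun γ : Idx n k =>
    hab _ (Filter.Eventually.of_forall fun y => (hmon γ).contDiffAt))
  let U : TopologicalSpace.Opens (Euc n) :=
    ⟨V ∩ X ∩ (Ψ.source ∩ Ψ ⁻¹' W), (hV.inter hXo).inter (Ψ.isOpen_inter_preimage hW)⟩
  have hUW : Set.MapsTo Ψ U W := fun z hz => hz.2.2
  have hΨU : ContDiffOn ℝ ∞ Ψ U := h.mono fun z hz => hz.2.1
  let w' : GVar n k → Euc n → ℝ := Sum.elim a fun l z => Ψ z l + 0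
  have hw' : ∀ i, ContDiffOn ℝ ∞ (w' i) U := by
    rintro (α | l)
    · exact (haV α).mono fun z hz => hz.1.1
    · exact ((EuclideanSpace.proj (𝕜 := ℝ) l).contDiff.comp_contDiffOn hΨU).add contDiffOn_const
  have hw : ∀ i, Restr (restr (U := U) (w' i) (hw' i)) (w' i) := fun i => restr_spec _ _
  have hg : IsFrameOf ((fun i => restr (U := U) (w' i) (hw' i)) ∘ Sum.inr) Ψ 0 :=
    isFrameOf_restr hΨU (fun z hz => det_jacobian_ne_zero h h' hz.2.1) fun l => hw (Sum.inr l)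
  let z : U := ⟨z₀, ⟨hzV, hzX⟩, hz, hzW⟩
  have hj : ∀ v, evalAt z (frameJet pd (fun i => restr (U := U) (w' i) (hw' i)) v) =
      jet b (Ψ z) v := fun v =>
    frameJet_eq_jet hw hg hW hUW hbW (fun γ z hz => hX z hz.1.2 γ) v z
  have : Nontrivial (Smooth U) := nontrivial_smoothFun z
  have hspec := specGraph_obstruction commDer_pd hg.isUnit P Q
  rw [hPQ] at hspec
  have h0 := congrArg (evalAt z) (specGraph_zero hspec)
  rw [evalAt_obstruction hw hj, map_zero] at h0
  exact (sub_eq_zero.mp h0).symm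

theorem diffHom_det {L : Type} [CommRing L] [Algebra ℝ L] (d : Fin n → Derivation ℝ L L)
    (w : GVar n k → L) :
    diffHom d w (Matrix.of fun l i => MvPolynomial.X (Sum.inr l, Pi.single i 1)).det =
      (jac d (w ∘ Sum.inr)).det := by
  rw [AlgHom.map_det]
  congr 1
  ext l i
  simp only [AlgHom.mapMatrix_apply, Matrix.map_apply, Matrix.of_apply, diffHom_X, jac]
  rw [multiIter_single]
  rfl

theorem genericDet_ne_zero :
    (Matrix.of fun l i => MvPolynomial.X (Sum.inr l, Pi.single i 1) :
      Matrix (Fin n) (Fin n) (DPoly n (GVar n k))).det ≠ 0 := by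
  intro h
  have := diffHom_det (n := n) (k := k) fieldD generic
  rw [h, map_zero] at this
  exact isUnit_jac_generic.ne_zero this.symm

theorem exists_eval_ne_zero {I : Type} {P : DPoly n I} (hP : P ≠ 0) : ∃ θ, P.eval θ ≠ 0 := by
  by_contra! h
  exact hP (MvPolynomial.funext fun θ => by rw [h, map_zero])

/-- An obstruction is seen by a local diffeomorphism and an operator. -/
theorem exists_of_obstruction_ne_zero {P Q : DPoly n (Idx n k)} (hPQ : obstruction P Q ≠ 0)
    (z₀ : Euc n) :
    ∃ (Ψ : OpenPartialHomeomorph (Euc n) (Euc n)) (a b : Coeffs n k),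
      ContDiffOn ℝ ∞ Ψ Ψ.source ∧ ContDiffOn ℝ ∞ Ψ.symm Ψ.target ∧ z₀ ∈ Ψ.source ∧ Ψ z₀ = z₀ ∧
      a.SmoothNear z₀ ∧ b.SmoothNear z₀ ∧ ChartPush Ψ z₀ a b ∧
      P.eval (jet a z₀) * Q.eval (jet b z₀) ≠ P.eval (jet b z₀) * Q.eval (jet a z₀) := by
  classical
  obtain ⟨N, D, hD, hND⟩ := IsFractionRing.div_surjective (A := DPoly n (GVar n k))
    (obstruction P Q)
  have hD0 := nonZeroDivisors.ne_zero hD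
  have hN0 : N ≠ 0 := by
    rintro rfl
    exact hPQ (by rw [← hND, map_zero, zero_div])
  set δ : DPoly n (GVar n k) :=
    (Matrix.of fun l i => MvPolynomial.X (Sum.inr l, Pi.single i 1)).det with hδ
  -- A jet at which both the numerator of the obstruction and the Jacobian determinant of the map
  -- are nonzero.
  obtain ⟨θ, hθ⟩ := exists_eval_ne_zero (mul_ne_zero hN0 (genericDet_ne_zero (n := n) (k := k)))
  rw [map_mul] at hθ
  obtain ⟨p, hp⟩ := exists_polyFun_jets (N.vars ∪ δ.vars) θ z₀
  let w' : GVar n k → Euc n → ℝ := fun i => polyFun (p i)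
  -- The map is translated so as to fix `z₀`. The frame functions remain `ψ_l + t_l`, so the
  -- prescribed jets are kept.
  let t : Fin n → ℝ := fun l => w' (Sum.inr l) z₀ - z₀ l
  let ψ : Euc n → Euc n := fun z => WithLp.toLp 2 fun l => w' (Sum.inr l) z - t l
  have hψ : ContDiff ℝ ∞ ψ :=
    contDiff_euclidean.mpr fun l => (contDiff_polyFun _).sub contDiff_const
  have hψz : ψ z₀ = z₀ := by
    ext l
    simp [ψ, t]
  have hψt : ∀ l, (fun z => ψ z l + t l) = w' (Sum.inr l) := fun l => by
    funext z
    simp [ψ]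
  have hNe : N.eval (jets w' z₀) ≠ 0 := by
    rw [eval_eq_of_jets fun v hv => hp v (Finset.mem_union_left _ hv)]
    exact left_ne_zero_of_mul hθ
  have hdet : (jacobian ψ z₀).det ≠ 0 := by
    have h1 : δ.eval (jets w' z₀) ≠ 0 := by
      rw [eval_eq_of_jets fun v hv => hp v (Finset.mem_union_right _ hv)]
      exact right_ne_zero_of_mul hθ
    have h2 : δ.eval (jets w' z₀) = (jacobian ψ z₀).det := by
      rw [hδ, RingHom.map_det]
      congr 1
      ext l i
      simp only [RingHom.mapMatrix_apply, Matrix.map_apply, Matrix.of_apply, MvPolynomial.eval_X,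
        jets, jacobian, multiIter_single, ← hψt]
      simp [partialD, fderiv_add_const]
    rwa [← h2]
  obtain ⟨Ψ, hΨψ, hzΨ, -, hsymm, hΨdet⟩ :=
    exists_local_diffeo isOpen_univ hψ.contDiffOn (Set.mem_univ z₀) hdet
  clear_value ψ
  subst hΨψ
  let a : Coeffs n k := fun α => w' (Sum.inl α)
  -- The coefficients of the push-forward, still as functions on the source; `Ψ.symm` carries them
  -- to the target.
  let c : Coeffs n k := fun γ z => (frameCoeff γ).eval (jets w' z)
  have hframe : ∀ U : TopologicalSpace.Opens (Euc n), (U : Set (Euc n)) ⊆ Ψ.source →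
      IsFrameOf ((fun i => restr (U := U) (w' i) (contDiff_polyFun _).contDiffOn) ∘ Sum.inr) Ψ t :=
    fun U hU => isFrameOf_restr hψ.contDiffOn (fun z hz => hΨdet z (hU hz)) fun l => by
      rw [hψt]
      exact restr_spec _ (contDiff_polyFun _).contDiffOn
  have hw : ∀ (U : TopologicalSpace.Opens (Euc n)) (i : GVar n k),
      Restr (restr (U := U) (w' i) (contDiff_polyFun _).contDiffOn) (w' i) :=
    fun U i => restr_spec _ _
  let U : TopologicalSpace.Opens (Euc n) := ⟨Ψ.source, Ψ.open_source⟩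
  have hc : ∀ γ, ContDiffOn ℝ ∞ (c γ) U := by
    intro γ
    obtain ⟨f, hf⟩ := exists_restr (diffHom pd
      (fun i => restr (U := U) (w' i) (contDiff_polyFun _).contDiffOn) (frameCoeff γ))
    refine hf.1.congr fun z hz => ?_
    rw [← hf.evalAt ⟨z, hz⟩, evalAt_diffHom (hw U)]
  let b : Coeffs n k := fun γ => c γ ∘ Ψ.symm
  have hb : ∀ γ, ContDiffOn ℝ ∞ (b γ) Ψ.target := fun γ =>
    (hc γ).comp hsymm fun y hy => Ψ.map_target hy
  have hbc : ∀ γ, ∀ z ∈ Ψ.source, b γ (Ψ z) = (frameCoeff γ).eval (jets w' z) := by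
    intro γ z hz
    simp only [b, Function.comp_apply, Ψ.left_inv hz, c]
  refine ⟨Ψ, a, b, hψ.contDiffOn, hsymm, hzΨ, hψz,
    fun α => Filter.Eventually.of_forall fun z => (contDiff_polyFun _).contDiffAt, fun γ => ?_,
    fun f hf => ?_, ?_⟩
  · have : z₀ ∈ Ψ.target := by
      rw [← hψz]
      exact Ψ.map_source hzΨ
    filter_upwards [Ψ.open_target.mem_nhds this] with y hy
    exact (hb γ).contDiffAt (Ψ.open_target.mem_nhds hy)
  · obtain ⟨W, hW, hWo, hzW⟩ := eventually_nhds_iff.mp hf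
    let U₁ : TopologicalSpace.Opens (Euc n) :=
      ⟨Ψ.source ∩ Ψ ⁻¹' W, Ψ.isOpen_inter_preimage hWo⟩
    filter_upwards [U₁.2.mem_nhds ⟨hzΨ, hzW⟩] with z hz
    exact chartOp_comp (hw U₁) (hframe U₁ fun z hz => hz.1) hWo (fun z hz => hz.2) hz
      (fun γ => hbc γ z hz.1) fun y hy => (hW y hy).contDiffWithinAt
  · intro heq
    let z : U := ⟨z₀, hzΨ⟩
    have : Nontrivial (Smooth U) := nontrivial_smoothFun z
    have hmon : ∀ γ : Idx n k, ContDiff ℝ ∞ fun y : Euc n => ∏ i, (y i + t i) ^ γ.entries i :=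
      fun γ => contDiff_prod fun i _ =>
        (((EuclideanSpace.proj (𝕜 := ℝ) i).contDiff (n := ∞)).add contDiff_const).pow _
    have hj : ∀ v, evalAt z (frameJet pd
        (fun i => restr (U := U) (w' i) (contDiff_polyFun _).contDiffOn) v) = jet b (Ψ z) v :=
      fun v => frameJet_eq_jet (hw U) (hframe U subset_rfl) Ψ.open_target Ψ.mapsTo hb
        (fun γ z hz => chartOp_comp (hw U) (hframe U subset_rfl) Ψ.open_target Ψ.mapsTo hz
          (fun γ => hbc γ z hz) (hmon γ).contDiffOn) v z
    -- The specialized obstruction times the value of `D` is the value of `N`, which is nonzero at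
    -- `z₀`; nothing need be known about `D` there.
    have hspec := specGraph_obstruction commDer_pd (hframe U subset_rfl).isUnit P Q
    have h0 := congrArg (evalAt z) (specGraph_mul_eq hspec
      (by rw [← hND, div_mul_cancel₀ _ (by simpa using hD0)]))
    rw [map_mul, evalAt_obstruction (hw U) hj, evalAt_diffHom (hw U) z N] at h0
    have hz : Ψ z = z₀ := hψz
    rw [hz] at h0
    apply hNe
    refine h0.symm.trans ?_
    have : jet (w' ∘ Sum.inl) z = jet a z₀ := rfl
    rw [this, ← heq, sub_self, zero_mul]

end LocalDiffeo


/-! ### Natural rational invariants in terms of the generic local diffeomorphism -/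

section Manifold

variable {n k : ℕ} {M : Type*} [TopologicalSpace M]
  {e : OpenPartialHomeomorph M (EuclideanSpace ℝ (Fin n))} {p : M}

theorem diffOp_eq_chartOp (a : Coeffs n k) (f : M → ℝ) (x : M) :
    diffOp e a f x = chartOp a (f ∘ e.symm) (e x) := rfl

variable [ChartedSpace (EuclideanSpace ℝ (Fin n)) M]

/-- Test functions are carried to `M` as `f ∘ e`; this suffices because differential operators
depend only on germs. -/
theorem IsPushforward.chartPush [IsManifold (𝓡 n) ∞ M]
    (he : e ∈ IsManifold.maximalAtlas (𝓡 n) ∞ M)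
    (hp : p ∈ e.source) {φ : M → M} (hφ : ContinuousAt φ p) (hφp : φ p = p) {a b : Coeffs n k}
    (h : IsPushforward e p φ a b) : ChartPush (e ∘ φ ∘ e.symm) (e p) a b := by
  intro f hf
  have hpt : e p ∈ e.target := e.map_source hp
  have hsp : e.symm (e p) = p := e.left_inv hp
  have hψp : (e ∘ φ ∘ e.symm) (e p) = e p := by simp [hsp, hφp]
  rw [hψp] at hf
  have hsymm : Filter.Tendsto e.symm (𝓝 (e p)) (𝓝 p) := by
    have := e.continuousAt_symm hpt
    rwa [ContinuousAt, hsp] at this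
  have hφt : Filter.Tendsto φ (𝓝 p) (𝓝 p) := by
    rwa [ContinuousAt, hφp] at hφ
  have h1 := h (f ∘ e) (by
    filter_upwards [(e.continuousAt hp).eventually hf, e.open_source.mem_nhds hp] with x hx hxs
    exact (contMDiffAt_iff_contDiffAt.mpr hx).comp x
      (contMDiffAt_of_mem_maximalAtlas he hxs))
  filter_upwards [hsymm.eventually h1, e.open_target.mem_nhds hpt,
    hsymm.eventually (hφt.eventually (e.open_source.mem_nhds hp))] with z hz hzt hzs
  rw [diffOp_eq_chartOp, diffOp_eq_chartOp, e.right_inv hzt] at hz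
  refine Eq.trans (chartOp_congr b ?_) hz
  filter_upwards [e.open_target.mem_nhds (e.map_source hzs)] with y hy
  simp [e.right_inv hy]

/-- The local diffeomorphism of the manifold which is given by `Ψ` in the chart `e`. -/
def chartDiffeo [IsManifold (𝓡 n) ∞ M] (he : e ∈ IsManifold.maximalAtlas (𝓡 n) ∞ M)
    (Ψ : OpenPartialHomeomorph (Euc n) (Euc n))
    (h : ContDiffOn ℝ ∞ Ψ Ψ.source) (h' : ContDiffOn ℝ ∞ Ψ.symm Ψ.target) :
    PartialDiffeomorph (𝓡 n) (𝓡 n) M M ∞ where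
  toPartialEquiv := ((e.trans Ψ).trans e.symm).toPartialEquiv
  open_source := ((e.trans Ψ).trans e.symm).open_source
  open_target := ((e.trans Ψ).trans e.symm).open_target
  contMDiffOn_toFun := by
    intro x hx
    have hx' : (x ∈ e.source ∧ e x ∈ Ψ.source) ∧ Ψ (e x) ∈ e.target := by
      simpa using (hx : x ∈ ((e.trans Ψ).trans e.symm).source)
    exact ((contMDiffAt_symm_of_mem_maximalAtlas he hx'.2).comp x
      ((contMDiffAt_iff_contDiffAt.mpr (h.contDiffAt (Ψ.open_source.mem_nhds hx'.1.2))).comp x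
        (contMDiffAt_of_mem_maximalAtlas he hx'.1.1))).contMDiffWithinAt
  contMDiffOn_invFun := by
    intro x hx
    have hx' : x ∈ e.source ∧ e x ∈ Ψ.target ∧ Ψ.symm (e x) ∈ e.target := by
      simpa using (hx : x ∈ ((e.trans Ψ).trans e.symm).target)
    exact ((contMDiffAt_symm_of_mem_maximalAtlas he hx'.2.2).comp x
      ((contMDiffAt_iff_contDiffAt.mpr (h'.contDiffAt (Ψ.open_target.mem_nhds hx'.2.1))).comp x
        (contMDiffAt_of_mem_maximalAtlas he hx'.1))).contMDiffWithinAt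

theorem ChartPush.isPushforward [IsManifold (𝓡 n) ∞ M]
    (he : e ∈ IsManifold.maximalAtlas (𝓡 n) ∞ M)
    (hp : p ∈ e.source) {Ψ : OpenPartialHomeomorph (Euc n) (Euc n)} (hpΨ : e p ∈ Ψ.source)
    (hΨ : Ψ (e p) = e p) {a b : Coeffs n k} (h : ChartPush Ψ (e p) a b) :
    IsPushforward e p ((e.trans Ψ).trans e.symm) a b := by
  intro f hf
  have hpt : e p ∈ e.target := e.map_source hp
  have hsp : e.symm (e p) = p := e.left_inv hp
  have hsymm : Filter.Tendsto e.symm (𝓝 (e p)) (𝓝 p) := by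
    have := e.continuousAt_symm hpt
    rwa [ContinuousAt, hsp] at this
  have hΨt : Filter.Tendsto Ψ (𝓝 (e p)) (𝓝 (e p)) := by
    have := Ψ.continuousAt hpΨ
    rwa [ContinuousAt, hΨ] at this
  have h1 := h (f ∘ e.symm) (by
    rw [hΨ]
    filter_upwards [hsymm.eventually hf, e.open_target.mem_nhds hpt] with y hy hyt
    exact contMDiffAt_iff_contDiffAt.mp (hy.comp y (contMDiffAt_symm_of_mem_maximalAtlas he hyt)))
  have he0 := e.continuousAt hp
  have hmem : ∀ᶠ z in 𝓝 (e p), z ∈ e.target ∧ Ψ z ∈ e.target :=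
    (e.open_target.eventually_mem hpt).and
      (hΨt.eventually (e.open_target.eventually_mem hpt))
  filter_upwards [he0.eventually h1, he0.eventually hmem.eventually_nhds,
    e.open_source.mem_nhds hp] with x hx hxm hxs
  have hx1 := hxm.self_of_nhds
  rw [diffOp_eq_chartOp, diffOp_eq_chartOp]
  have hv : e (((e.trans Ψ).trans e.symm) x) = Ψ (e x) := by
    simp [e.right_inv hx1.2]
  rw [hv, hx]
  apply chartOp_congr
  filter_upwards [hxm] with z hz
  simp [e.right_inv hz.1]

/-- A nonzero obstruction is detected by one local diffeomorphism in the chart, which is transported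
to `M`; a zero obstruction specializes to zero for every local diffeomorphism. The criterion
involves neither the representation `P / Q` nor `e` and `p`. -/
theorem isNatural_iff [IsManifold (𝓡 n) ∞ M] (he : e ∈ IsManifold.maximalAtlas (𝓡 n) ∞ M)
    (hp : p ∈ e.source) (F : RatFun n k) :
    IsNatural e p F ↔ pushHom n k F = inclHom n k F := by
  constructor
  · rintro ⟨P, Q, hQ, rfl, h⟩
    rw [← obstruction_eq_zero_iff hQ]
    by_contra hne
    obtain ⟨Ψ, a, b, h1, h2, h3, h4, h5, h6, h7, h8⟩ := exists_of_obstruction_ne_zero hne (e p)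
    refine h8 (h (chartDiffeo he Ψ h1 h2) a b ?_ ?_ h5 h6 (h7.isPushforward he hp h3 h4))
    · change p ∈ ((e.trans Ψ).trans e.symm).source
      simp [hp, h3, h4]
    · change ((e.trans Ψ).trans e.symm) p = p
      simp [h4, hp]
  · intro h
    obtain ⟨P, Q, hQ, rfl⟩ := IsFractionRing.div_surjective (A := DPoly n (Idx n k)) F
    have hQ0 := nonZeroDivisors.ne_zero hQ
    rw [← obstruction_eq_zero_iff hQ0] at h
    refine ⟨P, Q, hQ0, rfl, fun φ a b hps hφp ha hb hab => ?_⟩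
    let Φ := φ.toOpenPartialHomeomorph
    let Ψ := (e.symm.trans Φ).trans e
    have hc : ContinuousAt φ p := Φ.continuousAt hps
    have hsp : e.symm (e p) = p := e.left_inv hp
    have hΨp : Ψ (e p) = e p := by
      change e (φ (e.symm (e p))) = e p
      rw [hsp, hφp]
    have hsrc : e p ∈ Ψ.source := by
      have : φ p ∈ e.source := hφp.symm ▸ hp
      simp only [Ψ, OpenPartialHomeomorph.trans_source, OpenPartialHomeomorph.symm_source]
      refine ⟨⟨e.map_source hp, ?_⟩, ?_⟩
      · change e.symm (e p) ∈ φ.source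
        rwa [hsp]
      · change φ (e.symm (e p)) ∈ e.source
        rwa [hsp]
    have key := eval_jet_of_obstruction_eq_zero (Ψ := Ψ) h ?_ ?_ hsrc ha (hΨp.symm ▸ hb)
      (hab.chartPush he hp hc hφp)
    · rwa [hΨp] at key
    · intro z hz
      have hz' : (z ∈ e.target ∧ e.symm z ∈ φ.source) ∧ φ (e.symm z) ∈ e.source := by
        simpa [Ψ] using! hz
      have := (contMDiffAt_of_mem_maximalAtlas he hz'.2).comp z
        ((φ.contMDiffOn.contMDiffAt (φ.open_source.mem_nhds hz'.1.2)).comp z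
          (contMDiffAt_symm_of_mem_maximalAtlas he hz'.1.1))
      exact (contMDiffAt_iff_contDiffAt.mp this).contDiffWithinAt
    · intro z hz
      have hz' : z ∈ e.target ∧ e.symm z ∈ φ.target ∧ φ.symm (e.symm z) ∈ e.source := by
        simpa [Ψ] using! hz
      have := (contMDiffAt_of_mem_maximalAtlas he hz'.2.2).comp z
        ((φ.symm.contMDiffOn.contMDiffAt (φ.open_target.mem_nhds hz'.2.1)).comp z
          (contMDiffAt_symm_of_mem_maximalAtlas he hz'.1))
      exact (contMDiffAt_iff_contDiffAt.mp this).contDiffWithinAt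

end Manifold


/-! ### Polynomial changes of the invariant coordinates -/

section Density

variable {n k : ℕ}

/-- The jet of a composite depends only on the jets of the factors. -/
theorem multiIter_partialD_comp_eq {U : TopologicalSpace.Opens (Euc n)} {g : Fin n → Smooth U}
    {ψ : Euc n → Euc n} {t : Fin n → ℝ} (hg : IsFrameOf g ψ t) {W : Set (Euc n)} (hW : IsOpen W)
    (hUW : Set.MapsTo ψ U W) {f f' : Euc n → ℝ} (hf : ContDiffOn ℝ ∞ f W)
    (hf' : ContDiffOn ℝ ∞ f' W) (τ : Fin n → ℕ) {z : Euc n} (hz : z ∈ U)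
    (h : ∀ γ : Fin n → ℕ, ∑ i, γ i ≤ ∑ i, τ i →
      multiIter partialD γ f (ψ z) = multiIter partialD γ f' (ψ z)) :
    multiIter partialD τ (f ∘ ψ) z = multiIter partialD τ (f' ∘ ψ) z := by
  -- The universal chain rule separates the jets of `ψ` from those of `f`. No operator is involved,
  -- hence the empty index type `Fin 0`.
  have key : ∀ f, ContDiffOn ℝ ∞ f W → multiIter partialD τ (f ∘ ψ) z =
      (chainSymb (I := Fin 0) τ).sum fun γ m =>
        evalAt ⟨z, hz⟩ (diffHom pd (Sum.elim 0 g) m) * multiIter partialD γ f (ψ z) := by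
    intro f hf
    have hF := restr_spec (U := U) (f ∘ ψ) (hf.comp hg.contDiffOn hUW)
    rw [← (hF.multiIter τ).evalAt ⟨z, hz⟩,
      multiIter_eq_symbEval (w := Sum.elim (0 : Fin 0 → Smooth U) g) commDer_pd hg.isUnit,
      symbEval_apply, Finsupp.sum, map_sum]
    refine Finset.sum_congr rfl fun γ _ => ?_
    rw [map_mul]
    congr 1
    exact (hg.multiIter hW hUW hf hF γ).evalAt ⟨z, hz⟩
  rw [key f hf, key f' hf']
  refine Finset.sum_congr rfl fun γ hγ => ?_
  simp only
  rw [h γ (chainSymb_support τ γ hγ)]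

/-- Polynomials in local coordinates realize all jets of finite order. -/
theorem exists_polyFun_comp_jet {U : Set (Euc n)} (hU : IsOpen U) {ψ : Euc n → Euc n}
    (hψ : ContDiffOn ℝ ∞ ψ U) {z₀ : Euc n} (hz : z₀ ∈ U) (hdet : (jacobian ψ z₀).det ≠ 0)
    {r : Euc n → ℝ} (hr : ContDiff ℝ ∞ r) (m : ℕ) :
    ∃ h : MvPolynomial (Fin n) ℝ, ∀ τ : Fin n → ℕ, ∑ i, τ i ≤ m →
      multiIter partialD τ (polyFun h ∘ ψ) z₀ = multiIter partialD τ r z₀ := by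
  classical
  obtain ⟨Ψ, hΨψ, hzΨ, hΨU, hsymm, hΨdet⟩ := exists_local_diffeo hU hψ hz hdet
  -- The polynomial matches the jet of `r ∘ ψ⁻¹` at `ψ z₀`; `Idx n m` enumerates the multi-indices
  -- of length at most `m`.
  obtain ⟨h, hh⟩ := exists_polyFun_jet
    (Finset.univ.image (Idx.entries : Idx n m → Fin n → ℕ))
    (fun σ => multiIter partialD σ (r ∘ Ψ.symm) (ψ z₀)) (ψ z₀)
  refine ⟨h, fun τ hτ => ?_⟩
  let U₁ : TopologicalSpace.Opens (Euc n) := ⟨Ψ.source, Ψ.open_source⟩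
  have hfr : IsFrameOf (fun l => restr (U := U₁) (fun y => ψ y l + (0 : Fin n → ℝ) l)
      (((contDiffOn_euclidean.mp (hψ.mono hΨU)) l).add contDiffOn_const)) ψ 0 :=
    isFrameOf_restr (hψ.mono hΨU) hΨdet fun l => restr_spec _ _
  have hmaps : Set.MapsTo ψ U₁ Ψ.target := fun y hy => hΨψ ▸ Ψ.map_source hy
  rw [multiIter_partialD_comp_eq hfr Ψ.open_target hmaps (contDiff_polyFun h).contDiffOn
    (hr.comp_contDiffOn hsymm) τ hzΨ fun γ hγ =>
      hh γ (Finset.mem_image.mpr ⟨Idx.mk' γ (hγ.trans hτ), Finset.mem_univ _, rfl⟩)]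
  refine (multiIter_partialD_congr ?_ τ).eq_of_nhds
  filter_upwards [Ψ.open_source.mem_nhds hzΨ] with y hy
  simp only [Function.comp_apply, ← hΨψ, Ψ.left_inv hy]

/-- The evaluation of rational functions in general position on a generic operator gives local
coordinates. -/
theorem exists_realization {J : Fin n → RatFun n k} (hJ : IsUnit (jac fieldD J).det) :
    ∃ R : DPoly n (Idx n k), R ≠ 0 ∧ ∀ (a : Idx n k → Euc n → ℝ) (ha : ∀ α, ContDiff ℝ ∞ (a α))
      (z₀ : Euc n), R.eval (jets a z₀) ≠ 0 →
      ∃ (U : TopologicalSpace.Opens (Euc n)) (z : U) (_ : Nontrivial (Smooth U))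
        (g : Fin n → Smooth U), (z : Euc n) = z₀ ∧
        (∀ i, (J i, g i) ∈ specGraph (diffHom pd fun α => restr (a α) (ha α).contDiffOn)) ∧
        evalAt z (jac pd g).det ≠ 0 := by
  choose A B hB hAB using fun i => IsFractionRing.div_surjective (A := DPoly n (Idx n k)) (J i)
  obtain ⟨C, D, hD, hCD⟩ := IsFractionRing.div_surjective (A := DPoly n (Idx n k))
    (jac fieldD J).det
  have hB0 : ∀ i, B i ≠ 0 := fun i => nonZeroDivisors.ne_zero (hB i)
  have hD0 : D ≠ 0 := nonZeroDivisors.ne_zero hD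
  have hC0 : C ≠ 0 := by
    rintro rfl
    rw [map_zero, zero_div] at hCD
    exact hJ.ne_zero hCD.symm
  -- Where the denominators `B i` do not vanish, the `J i` become smooth functions; where the
  -- numerator `C` of their Jacobian determinant does not vanish either, they are local coordinates.
  refine ⟨(∏ i, B i) * C, mul_ne_zero (Finset.prod_ne_zero_iff.mpr fun i _ => hB0 i) hC0,
    fun a' ha' z₀ hz => ?_⟩
  rw [map_mul] at hz
  have hcont : Continuous fun z => (∏ i, B i).eval (jets a' z) := by
    have hr : ∀ α, Restr (restr (U := ⊤) (a' α) (ha' α).contDiffOn) (a' α) :=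
      fun α => restr_spec _ _
    obtain ⟨f, hf⟩ := exists_restr (diffHom pd
      (fun α => restr (U := ⊤) (a' α) (ha' α).contDiffOn) (∏ i, B i))
    have : f = fun z => (∏ i, B i).eval (jets a' z) := by
      funext z
      rw [← hf.evalAt ⟨z, trivial⟩, evalAt_diffHom hr]
    rw [← this]
    exact continuousOn_univ.mp hf.1.continuousOn
  let U : TopologicalSpace.Opens (Euc n) :=
    ⟨{z | (∏ i, B i).eval (jets a' z) ≠ 0}, isOpen_ne.preimage hcont⟩
  let z : U := ⟨z₀, left_ne_zero_of_mul hz⟩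
  have : Nontrivial (Smooth U) := nontrivial_smoothFun z
  have ha : ∀ α, Restr (restr (U := U) (a' α) (ha' α).contDiffOn) (a' α) := fun α => restr_spec _ _
  generalize hadef : (fun α => restr (U := U) (a' α) (ha' α).contDiffOn) = a at *
  replace ha : ∀ α, Restr (a α) (a' α) := fun α => hadef ▸ ha α
  have hBu : ∀ i, IsUnit (diffHom pd a (B i)) := by
    intro i
    apply isUnit_smoothFun
    intro y
    change evalAt y _ ≠ 0
    rw [evalAt_diffHom ha]
    have := y.2
    change (∏ i, B i).eval (jets a' y) ≠ 0 at this
    rw [map_prod] at this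
    exact Finset.prod_ne_zero_iff.mp this i (Finset.mem_univ i)
  have hgJ : ∀ i, (J i, diffHom pd a (A i) * Ring.inverse (diffHom pd a (B i))) ∈
      specGraph (diffHom pd a) := by
    intro i
    refine ⟨A i, B i, hBu i, ?_, ?_⟩
    · rw [← hAB i, div_mul_cancel₀ _ (by simpa using hB0 i)]
    · simp only
      rw [Ring.inverse_mul_cancel_right _ _ (hBu i)]
  refine ⟨U, z, this, fun i => diffHom pd a (A i) * Ring.inverse (diffHom pd a (B i)), rfl,
    hadef ▸ hgJ, ?_⟩
  have h1 := specGraph_mul_eq (specGraph_matrix (specGraph_jac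
    (fun i P => diffHom_polyD commDer_pd a i P) hgJ)).1 (N := C) (Q := D)
    (by rw [← hCD, div_mul_cancel₀ _ (by simpa using hD0)])
  have h2 := congrArg (evalAt z) h1
  rw [map_mul, evalAt_diffHom ha z C] at h2
  intro h0
  rw [h0, zero_mul] at h2
  exact right_ne_zero_of_mul hz h2.symm

/-- Polynomials in smooth functions are smooth functions. -/
theorem restr_aeval {U : TopologicalSpace.Opens (Euc n)} {g : Fin n → Smooth U}
    {ψ : Euc n → Euc n} (hψ : ContDiffOn ℝ ∞ ψ U) (hg : ∀ i, Restr (g i) fun y => ψ y i)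
    (h : MvPolynomial (Fin n) ℝ) : Restr (MvPolynomial.aeval g h) (polyFun h ∘ ψ) := by
  refine ⟨(contDiff_polyFun h).comp_contDiffOn hψ, fun y => ?_⟩
  change evalAt y (MvPolynomial.aeval g h) = _
  rw [MvPolynomial.comp_aeval_apply, funext fun i => (hg i).evalAt y]
  exact DFunLike.congr_fun (MvPolynomial.coe_aeval_eq_eval _) h

/-- Differential relations satisfied by rational functions persist under realization by smooth
functions. -/
theorem eval_jets_eq_zero {ι : Type} {U : TopologicalSpace.Opens (Euc n)}
    [Nontrivial (Smooth U)] {a : Idx n k → Smooth U} {w : ι → RatFun n k} {wL : ι → Smooth U}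
    (hw : ∀ i, (w i, wL i) ∈ specGraph (diffHom pd a)) {f : ι → Euc n → ℝ}
    (hf : ∀ i, Restr (wL i) (f i)) {N : DPoly n ι} (hN : diffHom fieldD w N = 0) (z : U) :
    N.eval (jets f z) = 0 := by
  have h := specGraph_diffHom (fun i P => diffHom_polyD commDer_pd a i P) hw N
  rw [hN] at h
  rw [← evalAt_diffHom hf, specGraph_zero h, map_zero]

/-- A nonzero differential polynomial in an operator and a map does not vanish identically on the
maps which are polynomials in functions in general position. -/
theorem exists_polynomial_frame {J : Fin n → RatFun n k} (hJ : IsUnit (jac fieldD J).det)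
    {N : DPoly n (GVar n k)} (hN : N ≠ 0) :
    ∃ h : Fin n → MvPolynomial (Fin n) ℝ,
      diffHom fieldD (Sum.elim generic fun i => MvPolynomial.aeval J (h i)) N ≠ 0 := by
  classical
  obtain ⟨R, hR0, hreal⟩ := exists_realization hJ
  have hR : inclPoly n k R ≠ 0 := by
    rw [← map_zero (inclPoly n k)]
    exact inclPoly_injective.ne hR0
  -- Besides `N`, also `R` must be nonzero at the chosen jet, so that the `J i` are local
  -- coordinates for the chosen operator.
  obtain ⟨θ, hθ⟩ := exists_eval_ne_zero (mul_ne_zero hN hR)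
  rw [map_mul] at hθ
  obtain ⟨p, hp⟩ := exists_polyFun_jets (N.vars ∪ (inclPoly n k R).vars) θ (0 : Euc n)
  obtain ⟨U, z, _, g, hz, hgJ, hdet⟩ := hreal (fun α => polyFun (p (Sum.inl α)))
    (fun α => contDiff_polyFun _) 0 (by
      have : R.eval (jets (fun α => polyFun (p (Sum.inl α))) (0 : Euc n)) =
          (inclPoly n k R).eval (jets (fun i => polyFun (p i)) 0) := by
        rw [inclPoly, MvPolynomial.eval_rename]
        rfl
      rw [this, eval_eq_of_jets fun v hv => hp v (Finset.mem_union_right _ hv)]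
      exact right_ne_zero_of_mul hθ)
  obtain ⟨a, ha, hgJ⟩ : ∃ a : Idx n k → Smooth U,
      (∀ α, Restr (a α) (polyFun (p (Sum.inl α)))) ∧
      ∀ i, (J i, g i) ∈ specGraph (diffHom pd a) := ⟨_, fun α => restr_spec _ _, hgJ⟩
  choose ψ' hψ' using fun i => exists_restr (g i)
  let ψ : Euc n → Euc n := fun y => WithLp.toLp 2 fun l => ψ' l y
  have hψ : ContDiffOn ℝ ∞ ψ U := contDiffOn_euclidean.mpr fun l => (hψ' l).1
  have hdet' : (jacobian ψ z).det ≠ 0 := by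
    have : evalAt z (jac pd g).det = (jacobian ψ z).det := by
      rw [AlgHom.map_det]
      congr 1
      ext l i
      exact ((hψ' l).pd i).evalAt z
    rwa [← this]
  obtain ⟨m, hm⟩ : ∃ m, ∀ v ∈ N.vars, ∑ i, v.2 i ≤ m :=
    ⟨N.vars.sup fun v => ∑ i, v.2 i,
      fun v hv => Finset.le_sup (f := fun v : GVar n k × (Fin n → ℕ) => ∑ i, v.2 i) hv⟩
  -- In these coordinates polynomials reproduce the jet of the chosen map up to the order `m` that
  -- occurs in `N`.
  choose h hh using fun l =>
    exists_polyFun_comp_jet U.2 hψ z.2 hdet' (contDiff_polyFun (p (Sum.inr l))) m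
  refine ⟨h, fun hzero => left_ne_zero_of_mul hθ ?_⟩
  have hpair : ∀ i, (Sum.elim generic (fun i => MvPolynomial.aeval J (h i)) i,
      Sum.elim a (fun i => MvPolynomial.aeval g (h i)) i) ∈ specGraph (diffHom pd a) :=
    Sum.rec (specGraph_generic a) fun l => specGraph_aeval hgJ (h l)
  have hrestr : ∀ i, Restr (Sum.elim a (fun i => MvPolynomial.aeval g (h i)) i)
      (Sum.elim (fun α => polyFun (p (Sum.inl α))) (fun l => polyFun (h l) ∘ ψ) i) :=
    Sum.rec ha fun l => restr_aeval hψ hψ' (h l)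
  rw [← eval_jets_eq_zero hpair hrestr hzero z]
  refine eval_eq_of_jets fun v hv => ?_
  rw [← hp v (Finset.mem_union_left _ hv)]
  obtain ⟨α | l, τ⟩ := v
  · rw [hz]
    rfl
  · rw [← hz]
    exact (hh l τ (hm _ hv)).symm

end Density

/-! ### The field generated by the Tresse derivatives -/

section Generated

variable {n k : ℕ}

/-- Entries of the inverse of a matrix over a subfield. -/
theorem inv_apply_mem {E : Type*} [Field E] [Algebra ℝ E] (K : IntermediateField ℝ E)
    {Y : Matrix (Fin n) (Fin n) E} (hY : ∀ i j, Y i j ∈ K) (i j : Fin n) : Y⁻¹ i j ∈ K := by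
  let Y₀ : Matrix (Fin n) (Fin n) K := Matrix.of fun i j => ⟨Y i j, hY i j⟩
  have h : K.val.toRingHom.mapMatrix Y₀ = Y := rfl
  rw [Matrix.inv_def, Matrix.smul_apply, Ring.inverse_eq_inv', smul_eq_mul, ← h,
    ← RingHom.map_det, ← RingHom.map_adjugate]
  exact K.mul_mem (K.inv_mem Y₀.det.2) (Y₀.adjugate i j).2

/-- By the sum, product and quotient rules, stability under a derivation needs to be checked on
generators only. -/
theorem derivation_mem_adjoin {E : Type*} [Field E] [Algebra ℝ E] (d : Derivation ℝ E E)
    {s : Set E} (h : ∀ x ∈ s, d x ∈ IntermediateField.adjoin ℝ s) {x : E}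
    (hx : x ∈ IntermediateField.adjoin ℝ s) : d x ∈ IntermediateField.adjoin ℝ s := by
  induction hx using IntermediateField.adjoin_induction with
  | mem x hx => exact h x hx
  | algebraMap r =>
    rw [Derivation.map_algebraMap]
    exact zero_mem _
  | add x y _ _ hx hy =>
    rw [map_add]
    exact add_mem hx hy
  | inv x hx' hx =>
    rw [Derivation.leibniz_inv, smul_eq_mul]
    exact mul_mem (neg_mem (pow_mem (inv_mem hx') 2)) hx
  | mul x y hx' hy' hx hy =>
    rw [Derivation.leibniz, smul_eq_mul, smul_eq_mul]
    exact add_mem (mul_mem hx' hy) (mul_mem hy' hx)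

theorem aeval_mem_subfield {E J : Type*} [Field E] [Algebra ℝ E] (K : IntermediateField ℝ E)
    {x : J → E} (hx : ∀ v, x v ∈ K) (P : MvPolynomial J ℝ) : MvPolynomial.aeval x P ∈ K := by
  induction P using MvPolynomial.induction_on with
  | C r =>
    rw [MvPolynomial.aeval_C]
    exact K.algebraMap_mem r
  | add P Q hP hQ =>
    rw [map_add]
    exact add_mem hP hQ
  | mul_X P v hP =>
    rw [map_mul, MvPolynomial.aeval_X]
    exact mul_mem hP (hx v)

/-- A rational invariant belongs to every field which contains coordinates in general position and
is stable under the derivatives in these coordinates and under the universal operator on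
monomials. -/
theorem mem_of_invariant {J : Fin n → RatFun n k} (hJ : IsUnit (jac fieldD J).det)
    (K : IntermediateField ℝ (RatFun n k)) (hJK : ∀ i, J i ∈ K)
    (hnab : ∀ i, ∀ x ∈ K, nab fieldD J i x ∈ K)
    (hbox : ∀ γ : Idx n k, box (∏ i, J i ^ γ.entries i) ∈ K) {F : RatFun n k}
    (hF : pushHom n k F = inclHom n k F) : F ∈ K := by
  obtain ⟨P, Q, hQ, rfl⟩ := IsFractionRing.div_surjective (A := DPoly n (Idx n k)) F
  have hQ0 : Q ≠ 0 := nonZeroDivisors.ne_zero hQ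
  rw [← obstruction_eq_zero_iff hQ0] at hF
  have hjQ : jetHom n k Q ≠ 0 := by simpa using jetHom_injective.ne hQ0
  obtain ⟨N, D, hD, hND⟩ := IsFractionRing.div_surjective (A := DPoly n (GVar n k)) (jetHom n k Q)
  have hD0 : D ≠ 0 := nonZeroDivisors.ne_zero hD
  have hN0 : N ≠ 0 := by
    rintro rfl
    exact hjQ (by rw [← hND, map_zero, zero_div])
  -- `N` may vanish on the frame `J` itself. The polynomials `h` are chosen so that `N` is nonzero
  -- on the frame `h(J)` and its Jacobian is invertible.
  obtain ⟨h, hh⟩ := exists_polynomial_frame hJ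
    (mul_ne_zero hN0 (genericDet_ne_zero (n := n) (k := k)))
  set w : GVar n k → RatFun n k := Sum.elim generic fun i => MvPolynomial.aeval J (h i) with hw
  rw [map_mul, diffHom_det] at hh
  have hu : IsUnit (jac fieldD (w ∘ Sum.inr)).det := (right_ne_zero_of_mul hh).isUnit
  have hgK : ∀ l, w (Sum.inr l) ∈ K := fun l =>
    aeval_mem_subfield K hJK (h l)
  -- the universal operator preserves `K`
  have hboxK : ∀ x ∈ K, box x ∈ K := by
    intro x hx
    have hframe : box x = _ := opApply_eq_frame (w := Sum.elim generic J) commDer_fieldD hJ x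
    rw [hframe]
    refine sum_mem fun γ _ => K.mul_mem ?_
      (multiIter_mem (s := (K : Set (RatFun n k))) hnab γ.entries hx)
    exact frameCoeff_mem (w := Sum.elim generic J) commDer_fieldD hJ
      K.toSubalgebra.toSubmodule (fun i x hx => K.mul_mem hx (hJK i)) hbox γ
  -- so do the derivatives in the new frame
  have hchain : ∀ j x, nab fieldD (w ∘ Sum.inr) j x =
      ∑ m, nab fieldD J m x * nab fieldD (w ∘ Sum.inr) j (J m) := by
    intro j x
    have h1 : ∀ i, fieldD i x = ∑ m, fieldD i (J m) * nab fieldD J m x := fun i =>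
      eq_sum_nab hJ i x
    rw [nab_apply]
    simp only [h1, nab_apply fieldD (w ∘ Sum.inr) j (J _), Finset.mul_sum]
    rw [Finset.sum_comm]
    exact Finset.sum_congr rfl fun m _ => Finset.sum_congr rfl fun i _ => by ring
  have hXK : ∀ m j, nab fieldD (w ∘ Sum.inr) j (J m) ∈ K := by
    intro m j
    -- The derivatives of `J` along the new frame form the inverse of the matrix of derivatives of
    -- the new frame along `J`, whose entries lie in `K`.
    let Y : Matrix (Fin n) (Fin n) (RatFun n k) :=
      Matrix.of fun l m => nab fieldD J m (w (Sum.inr l))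
    let X : Matrix (Fin n) (Fin n) (RatFun n k) :=
      Matrix.of fun m j => nab fieldD (w ∘ Sum.inr) j (J m)
    have hYX : Y * X = 1 := by
      ext l j
      rw [Matrix.mul_apply, Matrix.one_apply, ← nab_coord hu j l]
      exact (hchain j _).symm
    have := inv_apply_mem K (Y := Y) (fun l m => hnab m _ (hgK l)) m j
    rwa [Matrix.inv_eq_right_inv hYX] at this
  have hnabK : ∀ j, ∀ x ∈ (K : Set (RatFun n k)), nab fieldD (w ∘ Sum.inr) j x ∈ K := by
    intro j x hx
    rw [hchain]
    exact sum_mem fun m _ => K.mul_mem (hnab m x hx) (hXK m j)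
  have hjetK : ∀ v, frameJet fieldD w v ∈ K := fun v =>
    multiIter_mem (s := (K : Set (RatFun n k))) hnabK v.2 (frameCoeff_mem commDer_fieldD hu
      K.toSubalgebra.toSubmodule (fun i x hx => K.mul_mem hx (hgK i))
      (fun γ => hboxK _ (prod_mem fun i _ => pow_mem (hgK i) _)) v.1)
  have haevalK : ∀ P : DPoly n (Idx n k), MvPolynomial.aeval (frameJet fieldD w) P ∈ K := fun P =>
    aeval_mem_subfield K hjetK P
  have hQ' : MvPolynomial.aeval (frameJet fieldD w) Q ≠ 0 := by
    have h1 := specGraph_mul_eq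
      (specGraph_aeval (specGraph_frameJet commDer_fieldD hu) Q) (N := N) (Q := D)
      (by rw [← jetHom, ← hND, div_mul_cancel₀ _ (by simpa using hD0)])
    intro h0
    rw [h0, zero_mul] at h1
    exact left_ne_zero_of_mul hh h1.symm
  -- The invariance identity in the new frame turns `P / Q` into the same fraction evaluated at
  -- frame jets, which lie in `K`.
  have hspec := specGraph_obstruction commDer_fieldD hu P Q
  rw [hF] at hspec
  have h0 := specGraph_zero hspec
  have hgen : w ∘ Sum.inl = generic := rfl
  rw [hgen, diffHom_generic, diffHom_generic, sub_eq_zero] at h0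
  have hQa : algebraMap (DPoly n (Idx n k)) (RatFun n k) Q ≠ 0 := by simpa using hQ0
  rw [(div_eq_div_iff hQa hQ').mpr h0.symm]
  exact K.div_mem (haevalK P) (haevalK Q)

end Generated

end ScalarDiffOp

end

/-! ### The principle of n invariants -/

theorem mainTheorem10 {n k : ℕ}
    {M : Type*} [TopologicalSpace M] [ChartedSpace (EuclideanSpace ℝ (Fin n)) M]
    [IsManifold (𝓡 n) ∞ M] (p : M)
    (e : OpenPartialHomeomorph M (EuclideanSpace ℝ (Fin n)))
    (he : e ∈ IsManifold.maximalAtlas (𝓡 n) ∞ M) (hp : p ∈ e.source)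
    (J : Fin n → ScalarDiffOp.RatFun n k)
    (hnat : ∀ i, J i ∈ ScalarDiffOp.naturalField k e p)
    (hgen : ScalarDiffOp.GeneralPosition J) :
    ScalarDiffOp.naturalField k e p =
      IntermediateField.adjoin ℝ
        (Set.range J ∪
          {F | ∃ (α : ScalarDiffOp.Idx n k) (β : Fin n → ℕ),
            F = ScalarDiffOp.multiIter (ScalarDiffOp.tresse J) β
              (ScalarDiffOp.boxMonomial J α)}) := by
  open ScalarDiffOp in
  have hmem : ∀ F, F ∈ naturalField k e p ↔ pushHom n k F = inclHom n k F :=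
    isNatural_iff he hp
  have hu := hgen.isUnit_jac
  have htresse : tresse J = fun i F => nab fieldD J i F := by
    funext i F
    exact tresse_eq_nab J i F
  apply le_antisymm
  · intro F hF
    -- The generated field is stable under Tresse derivatives: they send each `J l` to 0 or 1 and
    -- raise `β` by one on the other generators. The case `β = 0` supplies the `J_α`.
    refine mem_of_invariant hu _ (fun i => IntermediateField.subset_adjoin ℝ _ (Or.inl ⟨i, rfl⟩))
      (fun i x hx => derivation_mem_adjoin _ ?_ hx)
      (fun γ => IntermediateField.subset_adjoin ℝ _ (Or.inr ⟨γ, 0, ?_⟩)) ((hmem F).mp hF)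
    · rintro x (⟨l, rfl⟩ | ⟨α, β, rfl⟩)
      · rw [nab_coord hu]
        split_ifs
        · exact one_mem _
        · exact zero_mem _
      · refine IntermediateField.subset_adjoin ℝ _ (Or.inr ⟨α, β + Pi.single i 1, ?_⟩)
        rw [htresse, multiIter_add_single (nab_comm commDer_fieldD hu)]
    · rw [multiIter_zero]
      rfl
  · rw [IntermediateField.adjoin_le_iff]
    have hinv := fun i => (hmem (J i)).mp (hnat i)
    rintro F (⟨l, rfl⟩ | ⟨α, β, rfl⟩)
    · exact hnat l
    · refine multiIter_mem (s := (naturalField k e p : Set (RatFun n k))) (fun i x hx => ?_) β ?_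
      · exact (hmem _).mpr (pushHom_tresse hgen hinv ((hmem x).mp hx) i)
      · exact (hmem _).mpr (pushHom_box ((hmem _).mp
          (prod_mem fun i _ => pow_mem (hnat i) _)))
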